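/- Let $\rho,b,c>0$ and let $r:[0,\infty)\to\mathbb R$ satisfy: (1) $r\in C^1([0,\infty))$ is non-decreasing; (2) $r(0)=0$ and $r(x)\le(b+\rho)x$ for $x$ close to $0$; (3) $a:=\lim_{x\to\infty}r(x)$ is finite; (4) $\lim_{x\to\infty}(a-r(x))x$ exists and is finite; (5) $\lim_{x\to\infty}r'(x)=0$. Let $(\Omega,\mathcal F,(\mathcal F_t)_{t\ge0},\mathbb P)$ be a filtered probability space. For $x\ge0$ consider the state equation without noise ($\sigma=0$) $$\dot x(t)=u(t)-b\,x(t)+r(x(t)),\qquad x(0)=x .$$ Let $\mathfrak U_x$ be the set of measurable, $\mathcal F_t$-adapted, $\mathbb P$-a.s. locally integrable processes $u$ with values in $(0,\infty)$ such that $\mathbb E\big[\int_0^\infty e^{-\rho t}\ln u(t)\,dt\big]<\infty$ (that is, the positive part of the integrand has a finite integral; the value $-\infty$ is allowed) and such that the state equation has a unique strong solution $x(\cdot)\ge0$. (Deterministic controls belong to this setting.) Define the value function $$V(x)=\sup_{u\in\mathfrak U_x}\mathbb E\Big[\int_0^\infty e^{-\rho t}\big(\ln u(t)-c\,x^2(t)\big)\,dt\Big].$$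 Then $V$ is finite and continuous on $[0,\infty)$, and it is a constrained viscosity solution on $[0,\infty)$ of the Hamilton–Jacobi–Bellman equation $$\rho V-(r(x)-bx)V'+\ln(-V')+cx^2+1=0,$$ i.e. a viscosity subsolution on $[0,\infty)$ and a viscosity supersolution on $(0,\infty)$: for every $\varphi\in C^1(\mathbb R)$, the expression $$\rho V(x_0)-(r(x_0)-bx_0)\varphi'(x_0)+\ln(-\varphi'(x_0))+cx_0^2+1$$ is $\le0$ whenever $V-\varphi$ has a local maximum relative to $[0,\infty)$ at $x_0\ge0$, and $\ge0$ whenever $V-\varphi$ has a local minimum at $x_0>0$, where $\ln(-p):=-\infty$ for $p\ge0$ (so the expression is $\rho V(x_0)-\sup_{u>0}\{(u-bx_0+r(x_0))p+\ln u-cx_0^2\}$ with $p=\varphi'(x_0)$). Moreover, $V$ is (one-sidedly) differentiable at $x=0$, $V'(0)<0$, and $V$ satisfies the equation there in the classical sense: $$\ln(-V'(0))+\rho V(0)+1=0 .$$ -/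

import Mathlib

open Set Filter Topology MeasureTheory
open scoped NNReal ENNReal

noncomputable section

namespace ShallowLake

/-- The standing assumptions on the recycling rate `r : [0,∞) → ℝ` (the values of `r` on the
negative half-line play no role). -/
structure IsRecyclingRate (b ρ : ℝ) (r : ℝ → ℝ) : Prop where
  contDiffOn : ContDiffOn ℝ 1 r (Ici 0)
  monotoneOn : MonotoneOn r (Ici 0)
  map_zero : r 0 = 0
  le_near_zero : ∀ᶠ x in 𝓝[≥] (0 : ℝ), r x ≤ (b + ρ) * x
  limits : ∃ a C : ℝ, Tendsto r atTop (𝓝 a) ∧ Tendsto (fun x => (a - r x) * x) atTop (𝓝 C)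
  tendsto_deriv : Tendsto (deriv r) atTop (𝓝 0)

section Control

variable {Ω : Type*} {mΩ : MeasurableSpace Ω} (P : Measure Ω) (ℱ : Filtration ℝ≥0 mΩ)

/-- `x` is a strong solution of `dx(t) = (u(t) - b x(t) + r(x(t))) dt`, `x(0) = x₀`: an adapted,
almost surely continuous process with values in the domain `[0,∞)` of `r` that almost surely
satisfies the integrated equation at all times.  Processes are written as functions on `ℝ`; only
their values at times `t ≥ 0` matter. -/
structure IsSolution (b : ℝ) (r : ℝ → ℝ) (x₀ : ℝ) (u x : ℝ → Ω → ℝ) : Prop where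
  adapted : Adapted ℱ (fun t : ℝ≥0 => x t)
  continuous : ∀ᵐ ω ∂P, ContinuousOn (fun t => x t ω) (Ici 0)
  nonneg : ∀ᵐ ω ∂P, ∀ t ≥ 0, 0 ≤ x t ω
  equation : ∀ᵐ ω ∂P, ∀ t ≥ 0,
    x t ω = x₀ + ∫ s in (0 : ℝ)..t, (u s ω - b * x s ω + r (x s ω))

/-- Admissible controls for the initial state `x₀`: adapted (and jointly measurable), almost surely
locally integrable processes with values in `(0,∞)` such that the expectation of
`∫₀^∞ e^{-ρt} ln u(t) dt` exists and is `< ∞` (that is, the positive part has a finite integral; the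
value `-∞` is allowed), for which the state equation has a unique strong solution. -/
structure IsAdmissible (ρ b : ℝ) (r : ℝ → ℝ) (x₀ : ℝ) (u : ℝ → Ω → ℝ) : Prop where
  adapted : Adapted ℱ (fun t : ℝ≥0 => u t)
  measurable : Measurable (fun q : ℝ≥0 × Ω => u q.1 q.2)
  pos : ∀ t ≥ 0, ∀ ω, 0 < u t ω
  locallyIntegrable : ∀ᵐ ω ∂P, ∀ T ≥ 0, IntervalIntegrable (fun t => u t ω) volume 0 T
  log_lt_top : ∫⁻ ω, (∫⁻ t in Ici (0 : ℝ),
    ENNReal.ofReal (Real.exp (-ρ * t) * Real.log (u t ω))) ∂P < ⊤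
  exists_solution : ∃ x, IsSolution P ℱ b r x₀ u x
  unique_solution : ∀ x y, IsSolution P ℱ b r x₀ u x → IsSolution P ℱ b r x₀ u y →
    ∀ᵐ ω ∂P, ∀ t ≥ 0, x t ω = y t ω

/-- The total benefit `E ∫₀^∞ e^{-ρt} (ln u(t) - c x(t)²) dt`, as an extended real number: integral
of the positive part minus integral of the negative part. -/
def benefit (ρ c : ℝ) (u x : ℝ → Ω → ℝ) : EReal :=
  ((∫⁻ ω, (∫⁻ t in Ici (0 : ℝ),
      ENNReal.ofReal (Real.exp (-ρ * t) * (Real.log (u t ω) - c * x t ω ^ 2))) ∂P : ℝ≥0∞) : EReal) -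
  ((∫⁻ ω, (∫⁻ t in Ici (0 : ℝ),
      ENNReal.ofReal (-(Real.exp (-ρ * t) * (Real.log (u t ω) - c * x t ω ^ 2)))) ∂P : ℝ≥0∞) : EReal)

/-- The value function for `σ = 0`: the supremum of the total benefit over all admissible controls,
where `x` is the state belonging to `u`. -/
def value (ρ b c : ℝ) (r : ℝ → ℝ) (x₀ : ℝ) : EReal :=
  sSup {j | ∃ u x : ℝ → Ω → ℝ, IsAdmissible P ℱ ρ b r x₀ u ∧ IsSolution P ℱ b r x₀ u x ∧
    j = benefit P ρ c u x}

end Control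

/-- The left-hand side `ρ v - (r(x) - b x) p + ln(-p) + c x² + 1` of the equation, with the
convention `ln(-p) = -∞` for `p ≥ 0`.  This is
`ρ v - sup_{u > 0} ((u - b x + r(x)) p + ln u - c x²)`, the supremum being `+∞` for `p ≥ 0`. -/
def hjb (ρ b c : ℝ) (r : ℝ → ℝ) (x v p : ℝ) : EReal :=
  if p < 0 then
    ((ρ * v - (r x - b * x) * p + Real.log (-p) + c * x ^ 2 + 1 : ℝ) : EReal)
  else ⊥

/-- `w` is a viscosity subsolution of `F(x, w, w') = 0` on `S` (extrema are relative to `S`). -/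
def IsViscositySubsolution (F : ℝ → ℝ → ℝ → EReal) (S : Set ℝ) (w : ℝ → ℝ) : Prop :=
  ∀ φ : ℝ → ℝ, ContDiff ℝ 1 φ → ∀ x ∈ S, IsLocalMaxOn (fun y => w y - φ y) S x →
    F x (w x) (deriv φ x) ≤ 0

/-- `w` is a viscosity supersolution of `F(x, w, w') = 0` on `S` (extrema are relative to `S`). -/
def IsViscositySupersolution (F : ℝ → ℝ → ℝ → EReal) (S : Set ℝ) (w : ℝ → ℝ) : Prop :=
  ∀ φ : ℝ → ℝ, ContDiff ℝ 1 φ → ∀ x ∈ S, IsLocalMinOn (fun y => w y - φ y) S x →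
    0 ≤ F x (w x) (deriv φ x)

/-- Constrained viscosity solutions on `[0,∞)` (state-constraint condition at `0`, for a
maximization problem): subsolution up to the boundary, supersolution in the interior. -/
def IsConstrainedViscositySolution (F : ℝ → ℝ → ℝ → EReal) (w : ℝ → ℝ) : Prop :=
  IsViscositySubsolution F (Ici 0) w ∧ IsViscositySupersolution F (Ioi 0) w

end ShallowLake

end

/-! The problem reduces to deterministic controls. Outside a null set, each trajectory of an
admissible control is either a deterministic path of finite payoff or has payoff `-∞`, so its payoff
is at most the deterministic supremum `pathValue`; deterministic controls are themselves admissible.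
Hence `value = pathValue` (`value_eq_pathValue`), and everything else concerns `pathValue`, written
V below.

Upper bounds on payoffs come from one inequality, `IsPath.integral_le`. Concavity gives ln u ≤ q u -
1 - ln q for every q > 0; substituting u = x' + b x - r(x) and integrating by parts removes u, so no
bound on the control is ever needed. Different slopes q serve different ends: q = 1 bounds V above,
q close to -φ'(x₀) gives the subsolution property, a huge q forces near-optimal paths out of small
neighbourhoods of 0, and q = exp(-(1 + ρ V(0))) identifies the derivative at 0.

Lower bounds on V come from following a segment x₀ + k t before an arbitrary path
(`linear_prefix_le_pathValue`). A control is admissible along it as soon as k + b x - r(x) > 0. This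
yields a local Lipschitz bound on V(x₂) - V(x₁) for x₁ < x₂, the supersolution property, and the
upper estimate of V near 0.

For the other half of continuity, a path is raised by a slowly growing function z, which needs only
a larger control and therefore does not lower ln u (`IsPath.exists_raised`); raising also respects
the constraint x ≥ 0. -/

namespace ShallowLake

/-! ### Bounds on the recycling rate. -/

/-- Nonnegative, bounded and Lipschitz on `[0,∞)`, with a common constant `K`. -/
structure IsTame (K : ℝ) (r : ℝ → ℝ) : Prop where
  nonneg : ∀ x ≥ 0, 0 ≤ r x
  le : ∀ x ≥ 0, r x ≤ K
  lipschitz : ∀ x ≥ 0, ∀ y ≥ 0, |r x - r y| ≤ K * |x - y|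

theorem IsTame.continuousOn {K : ℝ} {r : ℝ → ℝ} (h : IsTame K r) : ContinuousOn r (Ici 0) := by
  refine LipschitzOnWith.continuousOn (K := K.toNNReal) (LipschitzOnWith.of_dist_le_mul ?_)
  intro x hx y hy
  rw [Real.dist_eq, Real.dist_eq]
  exact (h.lipschitz x hx y hy).trans
    (mul_le_mul_of_nonneg_right (Real.le_coe_toNNReal K) (abs_nonneg _))

theorem IsTame.continuousOn_comp {K : ℝ} {r : ℝ → ℝ} (h : IsTame K r) {x : ℝ → ℝ} {s : Set ℝ}
    (hx : ContinuousOn x s) (h0 : ∀ t ∈ s, 0 ≤ x t) : ContinuousOn (fun t => r (x t)) s :=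
  h.continuousOn.comp hx h0

/-- Monotonicity places r between r(0) = 0 and its limit a. The derivative is continuous up to 0 and
tends to 0 at infinity, hence is bounded, and the mean value inequality gives the Lipschitz bound.
-/
theorem IsRecyclingRate.exists_isTame {b ρ : ℝ} {r : ℝ → ℝ} (hr : IsRecyclingRate b ρ r) :
    ∃ K > 0, IsTame K r := by
  obtain ⟨a, C, ha, -⟩ := hr.limits
  have hle : ∀ x ≥ 0, r x ≤ a := fun x hx => by
    refine ge_of_tendsto ha ?_
    filter_upwards [eventually_ge_atTop x] with y hy
    exact hr.monotoneOn hx (le_trans hx hy : (0 : ℝ) ≤ y) hy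
  have hnn : ∀ x ≥ 0, 0 ≤ r x := fun x hx => by
    have := hr.monotoneOn (mem_Ici.2 le_rfl) hx hx
    rwa [hr.map_zero] at this
  have hcont : ContinuousOn (derivWithin r (Ici 0)) (Ici 0) :=
    hr.contDiffOn.continuousOn_derivWithin (uniqueDiffOn_Ici 0) le_rfl
  obtain ⟨N, hN⟩ := eventually_atTop.1
    (hr.tendsto_deriv.eventually (Metric.ball_mem_nhds (0 : ℝ) one_pos))
  obtain ⟨B, hB⟩ := isCompact_Icc.exists_bound_of_continuousOn
    (hcont.mono (Icc_subset_Ici_self : Icc 0 (max N 1) ⊆ Ici 0))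
  have hbound : ∀ x ∈ Ici (0 : ℝ), ‖derivWithin r (Ici 0) x‖ ≤ max B 1 := by
    intro x hx
    rcases le_total x (max N 1) with h | h
    · exact (hB x ⟨hx, h⟩).trans (le_max_left _ _)
    · have hx0 : 0 < x := lt_of_lt_of_le one_pos ((le_max_right _ _).trans h)
      rw [derivWithin_of_mem_nhds (Ici_mem_nhds hx0)]
      have := hN x ((le_max_left _ _).trans h)
      rw [dist_zero_right] at this
      exact this.le.trans (le_max_right _ _)
  refine ⟨max (max B 1) a, lt_of_lt_of_le one_pos ((le_max_right _ _).trans (le_max_left _ _)),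
    hnn, fun x hx => (hle x hx).trans (le_max_right _ _), fun x hx y hy => ?_⟩
  have := (convex_Ici (0 : ℝ)).norm_image_sub_le_of_norm_derivWithin_le
    (hr.contDiffOn.differentiableOn (by norm_num)) hbound hy hx
  rw [Real.norm_eq_abs, Real.norm_eq_abs] at this
  exact this.trans (mul_le_mul_of_nonneg_right (le_max_left _ _) (abs_nonneg _))

/-! ### Discounted integrals and the tangent inequality for the logarithm. -/

/-- Integration by parts for a discounted primitive. -/
theorem integral_exp_mul_sub_primitive {ρ T : ℝ} {g : ℝ → ℝ}
    (hg : IntervalIntegrable g volume 0 T) :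
    ∫ t in (0 : ℝ)..T, Real.exp (-ρ * t) * (g t - ρ * ∫ s in (0 : ℝ)..t, g s) =
      Real.exp (-ρ * T) * ∫ s in (0 : ℝ)..T, g s := by
  have hf : AbsolutelyContinuousOnInterval (fun t : ℝ => Real.exp (-ρ * t)) 0 T :=
    ContDiffOn.absolutelyContinuousOnInterval (by fun_prop)
  have hw := hg.absolutelyContinuousOnInterval_intervalIntegral (c := 0) (by simp)
  have := hf.integral_deriv_mul_eq_sub hw
  simp only [intervalIntegral.integral_same, mul_zero, sub_zero] at this
  rw [← this]
  apply intervalIntegral.integral_congr_ae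
  filter_upwards [hg.ae_hasDerivAt_integral] with t ht hmem
  have h1 : HasDerivAt (fun t : ℝ => Real.exp (-ρ * t)) (Real.exp (-ρ * t) * (-ρ)) t := by
    simpa using ((hasDerivAt_id t).const_mul (-ρ)).exp
  have h2 := ht (uIoc_subset_uIcc hmem) 0 (by simp)
  rw [h1.deriv, h2.deriv]
  ring

theorem integrableOn_exp_neg_mul {ρ : ℝ} (hρ : 0 < ρ) :
    IntegrableOn (fun t : ℝ => Real.exp (-ρ * t)) (Ioi 0) :=
  integrableOn_exp_mul_Ioi (by linarith) 0

theorem integral_Ioi_exp_neg_mul {ρ : ℝ} (hρ : 0 < ρ) :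
    ∫ t in Ioi (0 : ℝ), Real.exp (-ρ * t) = 1 / ρ := by
  rw [integral_exp_mul_Ioi (by linarith)]
  simp [neg_div_neg_eq]

theorem integral_exp_neg_mul {ρ : ℝ} (hρ : 0 < ρ) (T : ℝ) :
    ∫ t in (0 : ℝ)..T, Real.exp (-ρ * t) = (1 - Real.exp (-ρ * T)) / ρ := by
  have hd : ∀ t ∈ uIcc 0 T, HasDerivAt (fun t : ℝ => -(Real.exp (-ρ * t) / ρ))
      (Real.exp (-ρ * t)) t := by
    intro t _
    have := (((hasDerivAt_id t).const_mul (-ρ)).exp.div_const ρ).neg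
    refine this.congr_deriv ?_
    simp only [id, mul_one]
    field_simp
  rw [intervalIntegral.integral_eq_sub_of_hasDerivAt hd
    (Continuous.intervalIntegrable (by fun_prop) _ _)]
  simp
  ring

/-- This is the tangent line at u = 1/q. Optimised over u it is the Legendre transform that produces
the terms ln(-V') + 1 of the equation. -/
theorem log_le_mul_sub {q u : ℝ} (hq : 0 < q) (hu : 0 < u) :
    Real.log u ≤ q * u - 1 - Real.log q := by
  have := Real.log_le_sub_one_of_pos (mul_pos hq hu)
  rw [Real.log_mul hq.ne' hu.ne'] at this
  linarith

/-! ### Deterministic paths and upper bounds on their payoff. -/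

/-- A deterministic control `u` with state `x` from `x₀` and finite payoff. -/
structure IsPath (ρ b : ℝ) (r : ℝ → ℝ) (x₀ : ℝ) (u x : ℝ → ℝ) : Prop where
  measurable : Measurable u
  pos : ∀ t ≥ 0, 0 < u t
  intervalIntegrable : ∀ T ≥ 0, IntervalIntegrable u volume 0 T
  continuousOn : ContinuousOn x (Ici 0)
  nonneg : ∀ t ≥ 0, 0 ≤ x t
  equation : ∀ t ≥ 0, x t = x₀ + ∫ s in (0 : ℝ)..t, (u s - b * x s + r (x s))
  integrableOn_log : IntegrableOn (fun t => Real.exp (-ρ * t) * Real.log (u t)) (Ioi 0)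
  integrableOn_sq : IntegrableOn (fun t => Real.exp (-ρ * t) * x t ^ 2) (Ioi 0)

/-- The payoff of a deterministic path. -/
noncomputable def payoff (ρ c : ℝ) (u x : ℝ → ℝ) : ℝ :=
  ∫ t in Ioi (0 : ℝ), Real.exp (-ρ * t) * (Real.log (u t) - c * x t ^ 2)

section Path

variable {ρ b c K x₀ : ℝ} {r u x : ℝ → ℝ}

theorem uIcc_zero_subset_Ici {T : ℝ} (hT : 0 ≤ T) : uIcc 0 T ⊆ Ici (0 : ℝ) := by
  rw [uIcc_of_le hT]; exact Icc_subset_Ici_self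

namespace IsPath

theorem initial (h : IsPath ρ b r x₀ u x) : x 0 = x₀ := by
  simpa using h.equation 0 le_rfl

theorem integrableOn_payoff (h : IsPath ρ b r x₀ u x) :
    IntegrableOn (fun t => Real.exp (-ρ * t) * (Real.log (u t) - c * x t ^ 2)) (Ioi 0) := by
  refine (h.integrableOn_log.sub (h.integrableOn_sq.const_mul c)).congr_fun (fun t _ => ?_)
    measurableSet_Ioi
  simp only [Pi.sub_apply]
  ring

theorem intervalIntegrable_payoff (h : IsPath ρ b r x₀ u x) {T : ℝ} (hT : 0 ≤ T) :
    IntervalIntegrable (fun t => Real.exp (-ρ * t) * (Real.log (u t) - c * x t ^ 2))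
      volume 0 T :=
  (intervalIntegrable_iff_integrableOn_Ioc_of_le hT).2
    (h.integrableOn_payoff.mono_set Ioc_subset_Ioi_self)

theorem continuousOn_rate (h : IsPath ρ b r x₀ u x) (hr : IsTame K r) :
    ContinuousOn (fun t => r (x t)) (Ici 0) :=
  hr.continuousOn_comp h.continuousOn h.nonneg

theorem intervalIntegrable_velocity (h : IsPath ρ b r x₀ u x) (hr : IsTame K r) {T : ℝ}
    (hT : 0 ≤ T) : IntervalIntegrable (fun s => u s - b * x s + r (x s)) volume 0 T := by
  have hs := uIcc_zero_subset_Ici hT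
  exact ((h.intervalIntegrable T hT).sub
    ((h.continuousOn.mono hs).intervalIntegrable.const_mul b)).add
    ((h.continuousOn_rate hr).mono hs).intervalIntegrable

theorem continuousOn_hamiltonian (h : IsPath ρ b r x₀ u x) (hr : IsTame K r) (q : ℝ) :
    ContinuousOn (fun t => Real.exp (-ρ * t) *
      (q * (ρ * (x t - x₀) + b * x t - r (x t)) - c * x t ^ 2 - 1 - Real.log q)) (Ici 0) := by
  have h1 := h.continuousOn
  have h2 := h.continuousOn_rate hr
  have h3 : ContinuousOn (fun t => ρ * (x t - x₀) + b * x t) (Ici 0) := by fun_prop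
  exact ContinuousOn.mul (by fun_prop) ((((h3.sub h2).const_mul q).sub (by fun_prop)).sub
    continuousOn_const |>.sub continuousOn_const)

/-- The payoff up to time `T` is bounded through the tangent `ln u ≤ q u - 1 - ln q`. -/
theorem integral_le (h : IsPath ρ b r x₀ u x) (hr : IsTame K r) {q T : ℝ} (hq : 0 < q)
    (hT : 0 ≤ T) :
    ∫ t in (0 : ℝ)..T, Real.exp (-ρ * t) * (Real.log (u t) - c * x t ^ 2) ≤
      Real.exp (-ρ * T) * (q * (x T - x₀)) + ∫ t in (0 : ℝ)..T, Real.exp (-ρ * t) *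
        (q * (ρ * (x t - x₀) + b * x t - r (x t)) - c * x t ^ 2 - 1 - Real.log q) := by
  have hs := uIcc_zero_subset_Ici hT
  have hv := h.intervalIntegrable_velocity hr hT
  have hH := ((h.continuousOn_hamiltonian (c := c) hr q).mono hs).intervalIntegrable
    (μ := volume)
  have hw : IntervalIntegrable (fun t => Real.exp (-ρ * t) *
      ((u t - b * x t + r (x t)) - ρ * (x t - x₀))) volume 0 T := by
    refine IntervalIntegrable.continuousOn_mul (hv.sub ?_) (by fun_prop)
    have h1 := h.continuousOn.mono hs
    exact ContinuousOn.intervalIntegrable (by fun_prop)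
  -- After the tangent bound, the only trace of u is q times the velocity; integration by parts
  -- trades it for the boundary term and q ρ (x - x₀).
  have hibp : Real.exp (-ρ * T) * (q * (x T - x₀)) =
      ∫ t in (0 : ℝ)..T, q * (Real.exp (-ρ * t) *
        ((u t - b * x t + r (x t)) - ρ * (x t - x₀))) := by
    have h1 := integral_exp_mul_sub_primitive (ρ := ρ) hv
    rw [intervalIntegral.integral_const_mul]
    have h2 : x T - x₀ = ∫ s in (0 : ℝ)..T, (u s - b * x s + r (x s)) := by
      rw [h.equation T hT]; ring
    rw [h2]
    have h3 : ∫ t in (0 : ℝ)..T, Real.exp (-ρ * t) *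
        ((u t - b * x t + r (x t)) - ρ * (x t - x₀)) = Real.exp (-ρ * T) *
        ∫ s in (0 : ℝ)..T, (u s - b * x s + r (x s)) := by
      rw [← h1]
      refine intervalIntegral.integral_congr (fun t ht => ?_)
      have := h.equation t (hs ht)
      rw [show x t - x₀ = ∫ s in (0 : ℝ)..t, (u s - b * x s + r (x s)) by rw [this]; ring]
    rw [h3]; ring
  rw [hibp, ← intervalIntegral.integral_add (hw.const_mul q) hH]
  refine intervalIntegral.integral_mono_on hT (h.intervalIntegrable_payoff hT)
    ((hw.const_mul q).add hH) (fun t ht => ?_)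
  have h1 := mul_le_mul_of_nonneg_left (log_le_mul_sub hq (h.pos t ht.1))
    (Real.exp_pos (-ρ * t)).le
  nlinarith [h1]

/-- The remaining path after time `τ`. -/
theorem shift (h : IsPath ρ b r x₀ u x) (hr : IsTame K r) {τ : ℝ} (hτ : 0 ≤ τ) :
    IsPath ρ b r (x τ) (fun t => u (t + τ)) (fun t => x (t + τ)) := by
  have hmp := measurePreserving_add_right (volume : Measure ℝ) τ
  have hemb := measurableEmbedding_addRight τ
  have hpre : (fun t : ℝ => t + τ) ⁻¹' Ioi τ = Ioi 0 := by
    rw [preimage_add_const_Ioi]; simp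
  have hexp : ∀ t, Real.exp (-ρ * t) = Real.exp (ρ * τ) * Real.exp (-ρ * (t + τ)) := fun t => by
    rw [← Real.exp_add]; congr 1; ring
  have hshift : ∀ f : ℝ → ℝ, IntegrableOn (fun t => Real.exp (-ρ * t) * f t) (Ioi 0) →
      IntegrableOn (fun t => Real.exp (-ρ * t) * f (t + τ)) (Ioi 0) := by
    intro f hf
    have h1 := (hmp.integrableOn_comp_preimage hemb).2 (hf.mono_set (Ioi_subset_Ioi hτ))
    rw [hpre] at h1
    refine IntegrableOn.congr_fun (h1.const_mul (Real.exp (ρ * τ))) (fun t _ => ?_)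
      measurableSet_Ioi
    simp only [Function.comp]
    rw [hexp t]; ring
  have hii : ∀ T ≥ 0, ∀ f : ℝ → ℝ, (∀ T ≥ 0, IntervalIntegrable f volume 0 T) →
      IntervalIntegrable f volume τ (T + τ) := fun T hT f hf =>
    (hf τ hτ).symm.trans (hf (T + τ) (by positivity))
  refine ⟨h.measurable.comp (measurable_add_const τ), fun t ht => h.pos _ (by positivity),
    fun T hT => ?_, ?_, fun t ht => h.nonneg _ (by positivity), fun t ht => ?_,
    hshift (fun t => Real.log (u t)) h.integrableOn_log,
    hshift (fun t => x t ^ 2) h.integrableOn_sq⟩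
  · have := (hii T hT u h.intervalIntegrable).comp_add_right τ
    simpa using this
  · refine h.continuousOn.comp (by fun_prop) (fun t ht => ?_)
    have : (0 : ℝ) ≤ t := ht
    exact add_nonneg this hτ
  · rw [intervalIntegral.integral_comp_add_right (fun s => u s - b * x s + r (x s)),
      h.equation (t + τ) (by positivity), h.equation τ hτ, zero_add, add_assoc,
      intervalIntegral.integral_add_adjacent_intervals (h.intervalIntegrable_velocity hr hτ)
      (hii t ht _ fun T hT => h.intervalIntegrable_velocity hr hT)]

end IsPath

theorem setIntegral_Ioi_shift (ρ τ : ℝ) (f : ℝ → ℝ) :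
    ∫ t in Ioi τ, Real.exp (-ρ * t) * f t =
      Real.exp (-ρ * τ) * ∫ t in Ioi (0 : ℝ), Real.exp (-ρ * t) * f (t + τ) := by
  have hmp := measurePreserving_add_right (volume : Measure ℝ) τ
  rw [← hmp.setIntegral_preimage_emb (measurableEmbedding_addRight τ), preimage_add_const_Ioi,
    sub_self, ← integral_const_mul]
  refine setIntegral_congr_fun measurableSet_Ioi (fun t _ => ?_)
  rw [← mul_assoc, ← Real.exp_add]
  congr 2; ring

theorem IsPath.payoff_eq (h : IsPath ρ b r x₀ u x) {τ : ℝ} (hτ : 0 ≤ τ) :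
    payoff ρ c u x = (∫ t in (0 : ℝ)..τ, Real.exp (-ρ * t) * (Real.log (u t) - c * x t ^ 2)) +
      Real.exp (-ρ * τ) * payoff ρ c (fun t => u (t + τ)) (fun t => x (t + τ)) := by
  unfold payoff
  rw [← setIntegral_Ioi_shift ρ τ (fun t => Real.log (u t) - c * x t ^ 2),
    intervalIntegral.integral_interval_add_Ioi h.integrableOn_payoff
    (h.integrableOn_payoff.mono_set (Ioi_subset_Ioi hτ))]

/-- An integrable function need not tend to 0 at infinity, but it is small at arbitrarily late
times. This suffices to discard the boundary term exp(-ρT) x(T). -/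
theorem frequently_lt_of_integrableOn {f : ℝ → ℝ} (hf : IntegrableOn f (Ioi 0)) {ε : ℝ}
    (hε : 0 < ε) : ∃ᶠ t in atTop, f t < ε := by
  intro hcon
  obtain ⟨N, hN⟩ := eventually_atTop.1 hcon
  have h1 : IntegrableOn (fun _ : ℝ => ε) (Ioi (max N 0)) := by
    refine (hf.mono_set (Ioi_subset_Ioi (le_max_right N 0))).mono' (by fun_prop) ?_
    filter_upwards [ae_restrict_mem measurableSet_Ioi] with t ht
    rw [Real.norm_of_nonneg hε.le]
    exact not_lt.1 (hN t ((le_max_left N 0).trans ht.le))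
  rw [integrableOn_const_iff] at h1
  simp [hε.ne'] at h1

/-- Take slope q = 1 and absorb (ρ + b) x into half of the cost c x². The other half is kept, so
that a lower bound on the payoff controls the discounted integral of x². -/
theorem IsPath.payoff_le (h : IsPath ρ b r x₀ u x) (hr : IsTame K r) (hρ : 0 < ρ)
    (hc : 0 < c) (hx₀ : 0 ≤ x₀) : payoff ρ c u x ≤ (ρ + b) ^ 2 / (2 * c * ρ) -
      c / 2 * ∫ t in Ioi (0 : ℝ), Real.exp (-ρ * t) * x t ^ 2 := by
  have hconst : ∫ t in Ioi (0 : ℝ), Real.exp (-ρ * t) * ((ρ + b) ^ 2 / (2 * c)) =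
      (ρ + b) ^ 2 / (2 * c * ρ) := by
    rw [integral_mul_const, integral_Ioi_exp_neg_mul hρ]; field_simp
  have hGint : IntegrableOn (fun t => Real.exp (-ρ * t) * ((ρ + b) ^ 2 / (2 * c)) -
      c / 2 * (Real.exp (-ρ * t) * x t ^ 2)) (Ioi 0) :=
    ((integrableOn_exp_neg_mul hρ).mul_const _).sub (h.integrableOn_sq.const_mul _)
  have hG : (ρ + b) ^ 2 / (2 * c * ρ) - c / 2 * ∫ t in Ioi (0 : ℝ), Real.exp (-ρ * t) * x t ^ 2 =
      ∫ t in Ioi (0 : ℝ), (Real.exp (-ρ * t) * ((ρ + b) ^ 2 / (2 * c)) -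
      c / 2 * (Real.exp (-ρ * t) * x t ^ 2)) := by
    rw [integral_sub ((integrableOn_exp_neg_mul hρ).mul_const _) (h.integrableOn_sq.const_mul _),
      hconst, integral_const_mul]
  rw [hG]
  refine le_of_forall_pos_le_add fun ε hε => ?_
  have hlim1 := intervalIntegral_tendsto_integral_Ioi 0 (h.integrableOn_payoff (c := c))
    tendsto_id
  have hlim2 := intervalIntegral_tendsto_integral_Ioi 0 hGint tendsto_id
  have hlim := hlim1.sub hlim2
  refine sub_le_iff_le_add'.1 (le_of_tendsto_of_frequently hlim ?_)
  have hexp : Tendsto (fun T : ℝ => Real.exp (-ρ * T)) atTop (𝓝 0) :=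
    Real.tendsto_exp_atBot.comp (tendsto_id.const_mul_atTop_of_neg (by linarith))
  refine ((frequently_lt_of_integrableOn h.integrableOn_sq (half_pos hε)).and_eventually
    ((hexp.eventually_lt_const (half_pos hε)).and (eventually_ge_atTop 0))).mono ?_
  rintro T ⟨h1, h2, h3⟩
  simp only [id]
  have hE := h.integral_le (c := c) hr one_pos h3
  have hs := uIcc_zero_subset_Ici h3
  have hmono : ∫ t in (0 : ℝ)..T, Real.exp (-ρ * t) *
        (1 * (ρ * (x t - x₀) + b * x t - r (x t)) - c * x t ^ 2 - 1 - Real.log 1) ≤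
      ∫ t in (0 : ℝ)..T, (Real.exp (-ρ * t) * ((ρ + b) ^ 2 / (2 * c)) -
      c / 2 * (Real.exp (-ρ * t) * x t ^ 2)) := by
    refine intervalIntegral.integral_mono_on h3
      ((h.continuousOn_hamiltonian hr 1).mono hs).intervalIntegrable
      ((intervalIntegrable_iff_integrableOn_Ioc_of_le h3).2
        (hGint.mono_set Ioc_subset_Ioi_self)) (fun t ht => ?_)
    have hH : 1 * (ρ * (x t - x₀) + b * x t - r (x t)) - c * x t ^ 2 - 1 - Real.log 1 ≤
        (ρ + b) ^ 2 / (2 * c) - c / 2 * x t ^ 2 := by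
      rw [Real.log_one]
      have := hr.nonneg _ (h.nonneg t ht.1)
      have h5 : (ρ + b) * x t ≤ (ρ + b) ^ 2 / (2 * c) + c / 2 * x t ^ 2 := by
        have : (ρ + b) ^ 2 / (2 * c) + c / 2 * x t ^ 2 - (ρ + b) * x t =
          ((ρ + b) - c * x t) ^ 2 / (2 * c) := by field_simp; ring
        have h6 : 0 ≤ ((ρ + b) - c * x t) ^ 2 / (2 * c) := by positivity
        linarith
      nlinarith [mul_nonneg hρ.le hx₀]
    have := mul_le_mul_of_nonneg_left hH (Real.exp_pos (-ρ * t)).le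
    linarith
  have hxT : Real.exp (-ρ * T) * (1 * (x T - x₀)) ≤ ε := by
    have hx1 : x T ≤ x T ^ 2 + 1 := by nlinarith [sq_nonneg (x T - 1), h.nonneg T h3]
    have := mul_le_mul_of_nonneg_left hx1 (Real.exp_pos (-ρ * T)).le
    nlinarith [mul_nonneg (Real.exp_pos (-ρ * T)).le hx₀]
  linarith

end Path

/-! ### The deterministic value function and its dynamic programming inequalities. -/

theorem IsTame.continuous_comp {K : ℝ} {r : ℝ → ℝ} (h : IsTame K r) {x : ℝ → ℝ}
    (hx : Continuous x) (h0 : ∀ t, 0 ≤ x t) : Continuous (fun t => r (x t)) :=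
  h.continuousOn.comp_continuous hx h0

/-- The deterministic value function, as a real number. -/
noncomputable def pathValue (ρ b c : ℝ) (r : ℝ → ℝ) (x₀ : ℝ) : ℝ :=
  sSup {j | ∃ u x, IsPath ρ b r x₀ u x ∧ j = payoff ρ c u x}

section Value

variable {ρ b c K x₀ : ℝ} {r u x : ℝ → ℝ}

theorem IsPath.payoff_le_const (h : IsPath ρ b r x₀ u x) (hr : IsTame K r) (hρ : 0 < ρ)
    (hc : 0 < c) (hx₀ : 0 ≤ x₀) : payoff ρ c u x ≤ (ρ + b) ^ 2 / (2 * c * ρ) := by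
  have h1 := h.payoff_le hr hρ hc hx₀
  have h2 : 0 ≤ ∫ t in Ioi (0 : ℝ), Real.exp (-ρ * t) * x t ^ 2 :=
    integral_nonneg fun t => by positivity
  have := mul_nonneg (half_pos hc).le h2
  linarith

theorem bddAbove_payoff (hr : IsTame K r) (hρ : 0 < ρ) (hc : 0 < c) (hx₀ : 0 ≤ x₀) :
    BddAbove {j | ∃ u x, IsPath ρ b r x₀ u x ∧ j = payoff ρ c u x} := by
  refine ⟨(ρ + b) ^ 2 / (2 * c * ρ), ?_⟩
  rintro _ ⟨u, x, h, rfl⟩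
  exact h.payoff_le_const hr hρ hc hx₀

theorem IsPath.payoff_le_pathValue (h : IsPath ρ b r x₀ u x) (hr : IsTame K r) (hρ : 0 < ρ)
    (hc : 0 < c) (hx₀ : 0 ≤ x₀) : payoff ρ c u x ≤ pathValue ρ b c r x₀ :=
  le_csSup (bddAbove_payoff hr hρ hc hx₀) ⟨u, x, h, rfl⟩

/-- A bounded path: the control `K + 1 - r (x t)`, whose state solves a linear equation. -/
theorem exists_isPath (hr : IsTame K r) (hK : 0 < K) (hρ : 0 < ρ) (hb : 0 < b) (hc : 0 < c)
    (hx₀ : 0 ≤ x₀) :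
    ∃ u x, IsPath ρ b r x₀ u x ∧ -(c * (x₀ + (K + 1) / b) ^ 2 / ρ) ≤ payoff ρ c u x := by
  -- Equilibrium of x' = K + 1 - b x. As 0 ≤ r ≤ K, the control lies in [1, K + 1] and its logarithm
  -- in [0, K]. The absolute value inside r makes u continuous on the whole line and is invisible
  -- for t ≥ 0.
  set X := (K + 1) / b with hX
  have hXpos : 0 < X := by positivity
  have hbX : b * X = K + 1 := by rw [hX]; field_simp
  set x : ℝ → ℝ := fun t => X + (x₀ - X) * Real.exp (-b * t) with hxdef
  set u : ℝ → ℝ := fun t => K + 1 - r |x t| with hudef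
  have hxc : Continuous x := by rw [hxdef]; fun_prop
  have hrc : Continuous fun t => r |x t| := hr.continuous_comp hxc.abs fun t => abs_nonneg _
  have huc : Continuous u := continuous_const.sub hrc
  have hu1 : ∀ t, 1 ≤ u t := fun t => by
    have := hr.le _ (abs_nonneg (x t)); simp only [hudef]; linarith
  have huK : ∀ t, u t ≤ K + 1 := fun t => by
    have := hr.nonneg _ (abs_nonneg (x t)); simp only [hudef]; linarith
  have hlog0 : ∀ t, 0 ≤ Real.log (u t) := fun t => Real.log_nonneg (hu1 t)
  have hlogK : ∀ t, Real.log (u t) ≤ K := fun t => by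
    have := Real.log_le_sub_one_of_pos (lt_of_lt_of_le one_pos (hu1 t))
    linarith [huK t]
  have hxnn : ∀ t ≥ 0, 0 ≤ x t := fun t ht => by
    have h1 : Real.exp (-b * t) ≤ 1 := Real.exp_le_one_iff.2 (by nlinarith)
    have h2 := Real.exp_pos (-b * t)
    simp only [hxdef]
    nlinarith [mul_nonneg hx₀ h2.le]
  have hxle : ∀ t ≥ 0, x t ≤ x₀ + X := fun t ht => by
    have h1 : Real.exp (-b * t) ≤ 1 := Real.exp_le_one_iff.2 (by nlinarith)
    have h2 := Real.exp_pos (-b * t)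
    simp only [hxdef]
    nlinarith [mul_nonneg hXpos.le h2.le]
  have hsq : ∀ t ≥ 0, x t ^ 2 ≤ (x₀ + X) ^ 2 := fun t ht => by
    have := hxnn t ht; have := hxle t ht; gcongr
  have hpath : IsPath ρ b r x₀ u x := by
    refine ⟨huc.measurable, fun t _ => lt_of_lt_of_le one_pos (hu1 t),
      fun T _ => huc.intervalIntegrable _ _, hxc.continuousOn, hxnn, fun t ht => ?_, ?_, ?_⟩
    · have hd : ∀ s ∈ uIcc 0 t, HasDerivAt x (K + 1 - b * x s) s := fun s _ => by
        have := ((((hasDerivAt_id s).const_mul (-b)).exp).const_mul (x₀ - X)).const_add X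
        refine this.congr_deriv ?_
        simp only [hxdef, id, ← hbX]
        ring
      have h1 := intervalIntegral.integral_eq_sub_of_hasDerivAt hd
        (Continuous.intervalIntegrable (by fun_prop) _ _)
      have h2 : ∫ s in (0 : ℝ)..t, (u s - b * x s + r (x s)) =
          ∫ s in (0 : ℝ)..t, (K + 1 - b * x s) := by
        refine intervalIntegral.integral_congr (fun s hs => ?_)
        have := hxnn s (uIcc_zero_subset_Ici ht hs)
        simp only [hudef, abs_of_nonneg this]
        ring
      rw [h2, h1]
      simp [hxdef]
    · refine Integrable.mono' ((integrableOn_exp_neg_mul hρ).mul_const K) ?_ ?_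
      · exact ((by fun_prop : Continuous fun t : ℝ => Real.exp (-ρ * t)).mul
          (huc.log fun t => by have := hu1 t; positivity)).aestronglyMeasurable
      · refine ae_of_all _ fun t => ?_
        rw [Real.norm_of_nonneg (mul_nonneg (Real.exp_pos _).le (hlog0 t))]
        exact mul_le_mul_of_nonneg_left (hlogK t) (Real.exp_pos _).le
    · refine Integrable.mono' ((integrableOn_exp_neg_mul hρ).mul_const ((x₀ + X) ^ 2))
        (Continuous.aestronglyMeasurable (by fun_prop)) ?_
      filter_upwards [ae_restrict_mem measurableSet_Ioi] with t ht
      rw [Real.norm_of_nonneg (by positivity)]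
      exact mul_le_mul_of_nonneg_left (hsq t (le_of_lt ht)) (Real.exp_pos _).le
  refine ⟨u, x, hpath, ?_⟩
  have h1 : -(c * (x₀ + X) ^ 2 / ρ) =
      ∫ t in Ioi (0 : ℝ), Real.exp (-ρ * t) * (-(c * (x₀ + X) ^ 2)) := by
    rw [integral_mul_const, integral_Ioi_exp_neg_mul hρ]; ring
  rw [h1]
  refine setIntegral_mono_on ((integrableOn_exp_neg_mul hρ).mul_const _)
    hpath.integrableOn_payoff measurableSet_Ioi fun t ht => ?_
  refine mul_le_mul_of_nonneg_left ?_ (Real.exp_pos _).le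
  have := mul_le_mul_of_nonneg_left (hsq t (le_of_lt ht)) hc.le
  linarith [hlog0 t]

theorem nonempty_payoff (hr : IsTame K r) (hK : 0 < K) (hρ : 0 < ρ) (hb : 0 < b) (hc : 0 < c)
    (hx₀ : 0 ≤ x₀) : {j | ∃ u x, IsPath ρ b r x₀ u x ∧ j = payoff ρ c u x}.Nonempty := by
  obtain ⟨u, x, h, -⟩ := exists_isPath hr hK hρ hb hc hx₀
  exact ⟨_, u, x, h, rfl⟩

theorem pathValue_le (hr : IsTame K r) (hK : 0 < K) (hρ : 0 < ρ) (hb : 0 < b) (hc : 0 < c)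
    (hx₀ : 0 ≤ x₀) {B : ℝ} (hB : ∀ u x, IsPath ρ b r x₀ u x → payoff ρ c u x ≤ B) :
    pathValue ρ b c r x₀ ≤ B := by
  refine csSup_le (nonempty_payoff hr hK hρ hb hc hx₀) ?_
  rintro _ ⟨u, x, h, rfl⟩
  exact hB u x h

theorem pathValue_le_const (hr : IsTame K r) (hK : 0 < K) (hρ : 0 < ρ) (hb : 0 < b)
    (hc : 0 < c) (hx₀ : 0 ≤ x₀) : pathValue ρ b c r x₀ ≤ (ρ + b) ^ 2 / (2 * c * ρ) :=
  pathValue_le hr hK hρ hb hc hx₀ fun _ _ h => h.payoff_le_const hr hρ hc hx₀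

theorem le_pathValue (hr : IsTame K r) (hK : 0 < K) (hρ : 0 < ρ) (hb : 0 < b)
    (hc : 0 < c) (hx₀ : 0 ≤ x₀) :
    -(c * (x₀ + (K + 1) / b) ^ 2 / ρ) ≤ pathValue ρ b c r x₀ := by
  obtain ⟨u, x, h, hJ⟩ := exists_isPath hr hK hρ hb hc hx₀
  exact hJ.trans (h.payoff_le_pathValue hr hρ hc hx₀)

theorem exists_lt_payoff (hr : IsTame K r) (hK : 0 < K) (hρ : 0 < ρ) (hb : 0 < b)
    (hc : 0 < c) (hx₀ : 0 ≤ x₀) {ε : ℝ} (hε : 0 < ε) :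
    ∃ u x, IsPath ρ b r x₀ u x ∧ pathValue ρ b c r x₀ - ε < payoff ρ c u x := by
  obtain ⟨_, ⟨u, x, h, rfl⟩, hlt⟩ := exists_lt_of_lt_csSup
    (nonempty_payoff hr hK hρ hb hc hx₀) (sub_lt_self (pathValue ρ b c r x₀) hε)
  exact ⟨u, x, h, hlt⟩

/-- The dynamic programming inequality combined with the tangent bound on the logarithm. -/
theorem IsPath.payoff_le_of_time (h : IsPath ρ b r x₀ u x) (hr : IsTame K r) (hρ : 0 < ρ)
    (hc : 0 < c) {q τ : ℝ} (hq : 0 < q) (hτ : 0 ≤ τ) :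
    payoff ρ c u x ≤ Real.exp (-ρ * τ) * (pathValue ρ b c r (x τ) + q * (x τ - x₀)) +
      ∫ t in (0 : ℝ)..τ, Real.exp (-ρ * t) *
        (q * (ρ * (x t - x₀) + b * x t - r (x t)) - c * x t ^ 2 - 1 - Real.log q) := by
  rw [h.payoff_eq hτ]
  have h1 := h.integral_le (c := c) hr hq hτ
  have h2 := mul_le_mul_of_nonneg_left
    ((h.shift hr hτ).payoff_le_pathValue hr hρ hc (h.nonneg τ hτ)) (Real.exp_pos (-ρ * τ)).le
  linarith

theorem IsPath.payoff_le_of_time_of_le (h : IsPath ρ b r x₀ u x) (hr : IsTame K r) (hρ : 0 < ρ)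
    (hc : 0 < c) {q τ B : ℝ} (hq : 0 < q) (hτ : 0 ≤ τ)
    (hB : ∀ t ∈ Icc 0 τ,
      q * (ρ * (x t - x₀) + b * x t - r (x t)) - c * x t ^ 2 - 1 - Real.log q ≤ B) :
    payoff ρ c u x ≤ Real.exp (-ρ * τ) * (pathValue ρ b c r (x τ) + q * (x τ - x₀)) +
      B * ((1 - Real.exp (-ρ * τ)) / ρ) := by
  refine (h.payoff_le_of_time hr hρ hc hq hτ).trans (add_le_add_right ?_ _)
  rw [← integral_exp_neg_mul hρ τ, mul_comm B, ← intervalIntegral.integral_mul_const]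
  refine intervalIntegral.integral_mono_on hτ
    ((h.continuousOn_hamiltonian hr q).mono (uIcc_zero_subset_Ici hτ)).intervalIntegrable
    (Continuous.intervalIntegrable (by fun_prop) _ _) fun t ht => ?_
  exact mul_le_mul_of_nonneg_left (hB t ht) (Real.exp_pos _).le

/-- Prefixing a path by a linear piece. -/
theorem IsPath.exists_linear_prefix {k h : ℝ} (hr : IsTame K r) (hh : 0 < h)
    (hp : IsPath ρ b r (x₀ + k * h) u x) (hnn : ∀ t ∈ Icc 0 h, 0 ≤ x₀ + k * t)
    (hpos : ∀ t ∈ Icc 0 h, 0 < k + b * (x₀ + k * t) - r (x₀ + k * t)) :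
    ∃ v y, IsPath ρ b r x₀ v y ∧ payoff ρ c v y =
      (∫ t in (0 : ℝ)..h, Real.exp (-ρ * t) *
        (Real.log (k + b * (x₀ + k * t) - r (x₀ + k * t)) - c * (x₀ + k * t) ^ 2)) +
      Real.exp (-ρ * h) * payoff ρ c u x := by
  set l : ℝ → ℝ := fun t => x₀ + k * t with hl
  have hlc : Continuous l := by rw [hl]; fun_prop
  have hrl : Continuous fun t => r |l t| := hr.continuous_comp hlc.abs fun t => abs_nonneg _
  set w : ℝ → ℝ := fun t => k + b * l t - r |l t| with hw
  have hwc : Continuous w := by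
    rw [hw]; exact (continuous_const.add (hlc.const_mul b)).sub hrl
  have hwl : ∀ t ∈ Icc 0 h, w t = k + b * l t - r (l t) := fun t ht => by
    have : 0 ≤ l t := hnn t ht
    simp only [hw, abs_of_nonneg this]
  have hwpos : ∀ t ∈ Icc 0 h, 0 < w t := fun t ht => by
    rw [hwl t ht]; exact hpos t ht
  set v : ℝ → ℝ := fun t => if t ≤ h then w t else u (t - h) with hv
  -- Clamping the two time arguments makes the glued state continuous without a case split; at every
  -- time one of the two pieces cancels against x₀ + k h.
  set y : ℝ → ℝ := fun t => l (min t h) + (x (max (t - h) 0) - (x₀ + k * h)) with hy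
  have hy1 : ∀ t ≤ h, y t = l t := fun t ht => by
    simp only [hy, min_eq_left ht, max_eq_right (sub_nonpos.2 ht), hp.initial]; ring
  have hy2 : ∀ t ≥ h, y t = x (t - h) := fun t ht => by
    simp only [hy, min_eq_right ht, max_eq_left (sub_nonneg.2 ht), hl]; ring
  have hv1 : ∀ t ≤ h, v t = w t := fun t ht => if_pos ht
  have hv2 : ∀ t > h, v t = u (t - h) := fun t ht => if_neg (not_le.2 ht)
  have hunion : Ioc 0 h ∪ Ioi h = Ioi (0 : ℝ) := Ioc_union_Ioi_eq_Ioi hh.le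
  have hyc : ContinuousOn y (Ici 0) := by
    have h1 : Continuous fun t => x (max (t - h) 0) :=
      hp.continuousOn.comp_continuous (by fun_prop) fun t => mem_Ici.2 (le_max_right _ _)
    exact ((hlc.comp (continuous_id.min continuous_const)).add
      (h1.sub continuous_const)).continuousOn
  have hynn : ∀ t ≥ 0, 0 ≤ y t := fun t ht => by
    rcases le_total t h with h1 | h1
    · rw [hy1 t h1]; exact hnn t ⟨ht, h1⟩
    · rw [hy2 t h1]; exact hp.nonneg _ (sub_nonneg.2 h1)
  have hmp := measurePreserving_add_right (volume : Measure ℝ) h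
  have hemb := measurableEmbedding_addRight h
  have hpre : (fun t : ℝ => t + h) ⁻¹' Ioi h = Ioi 0 := by rw [preimage_add_const_Ioi]; simp
  have hshift : ∀ f g : ℝ → ℝ, (∀ t > h, g t = f (t - h)) →
      IntegrableOn (fun t => Real.exp (-ρ * t) * f t) (Ioi 0) →
      IntegrableOn (fun t => Real.exp (-ρ * t) * g t) (Ioi h) := by
    intro f g hfg hf
    rw [← hmp.integrableOn_comp_preimage hemb, hpre]
    refine IntegrableOn.congr_fun (hf.const_mul (Real.exp (-ρ * h))) (fun t ht => ?_)
      measurableSet_Ioi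
    have ht0 : (0 : ℝ) < t := ht
    simp only [Function.comp]
    rw [hfg (t + h) (by linarith), add_sub_cancel_right, ← mul_assoc, ← Real.exp_add]
    congr 2; ring
  have hvint : ∀ T ≥ h, IntervalIntegrable v volume 0 T := fun T hT => by
    have h1 : IntervalIntegrable v volume 0 h := by
      refine (hwc.intervalIntegrable 0 h).congr fun t ht => ?_
      rw [uIoc_of_le hh.le] at ht
      exact (hv1 t ht.2).symm
    have h2 : IntervalIntegrable v volume h T := by
      have := (hp.intervalIntegrable (T - h) (sub_nonneg.2 hT)).comp_sub_right h
      rw [zero_add, sub_add_cancel] at this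
      refine this.congr fun t ht => ?_
      rw [uIoc_of_le hT] at ht
      exact (hv2 t ht.1).symm
    exact h1.trans h2
  have hfirst : ∀ t ∈ Icc 0 h, ∫ s in (0 : ℝ)..t, (v s - b * y s + r (y s)) = k * t := by
    intro t ht
    have : ∫ s in (0 : ℝ)..t, (v s - b * y s + r (y s)) = ∫ _ in (0 : ℝ)..t, k := by
      refine intervalIntegral.integral_congr fun s hs => ?_
      rw [uIcc_of_le ht.1] at hs
      have hs' : s ∈ Icc 0 h := ⟨hs.1, hs.2.trans ht.2⟩
      rw [hv1 s hs'.2, hy1 s hs'.2, hwl s hs']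
      ring
    rw [this]
    simp [mul_comm]
  have hrate : ContinuousOn (fun t => r (y t)) (Ici 0) := hr.continuousOn_comp hyc hynn
  have hpath : IsPath ρ b r x₀ v y := by
    refine ⟨?_, fun t ht => ?_, fun T hT => ?_, hyc, hynn, fun t ht => ?_, ?_, ?_⟩
    · exact Measurable.ite measurableSet_Iic hwc.measurable
        (hp.measurable.comp (measurable_id.sub_const h))
    · rcases le_or_gt t h with h1 | h1
      · rw [hv1 t h1]; exact hwpos t ⟨ht, h1⟩
      · rw [hv2 t h1]; exact hp.pos _ (sub_nonneg.2 h1.le)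
    · refine (hvint (max T h) (le_max_right _ _)).mono_set ?_
      rw [uIcc_of_le hT, uIcc_of_le (hT.trans (le_max_left _ _))]
      exact Icc_subset_Icc_right (le_max_left _ _)
    · rcases le_total t h with h1 | h1
      · rw [hfirst t ⟨ht, h1⟩, hy1 t h1]
      · have hint : ∀ T ≥ h, IntervalIntegrable (fun s => v s - b * y s + r (y s))
            volume 0 T := fun T hT => by
          have hs := uIcc_zero_subset_Ici (hh.le.trans hT)
          exact ((hvint T hT).sub ((hyc.mono hs).intervalIntegrable.const_mul b)).add
            (hrate.mono hs).intervalIntegrable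
        rw [← intervalIntegral.integral_add_adjacent_intervals (hint h le_rfl)
          ((hint h le_rfl).symm.trans (hint t h1)), hfirst h ⟨hh.le, le_rfl⟩, hy2 t h1,
          hp.equation _ (sub_nonneg.2 h1), add_assoc]
        congr 2
        rw [← sub_self h, ← intervalIntegral.integral_comp_sub_right
          (fun s => u s - b * x s + r (x s)) h]
        refine intervalIntegral.integral_congr_ae (ae_of_all _ fun s hs => ?_)
        rw [uIoc_of_le h1] at hs
        rw [hv2 s hs.1, hy2 s hs.1.le]
    · rw [← hunion]
      refine IntegrableOn.union ?_ (hshift (fun t => Real.log (u t)) _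
        (fun t ht => by rw [hv2 t ht]) hp.integrableOn_log)
      have : ContinuousOn (fun t => Real.exp (-ρ * t) * Real.log (w t)) (Icc 0 h) :=
        ContinuousOn.mul (by fun_prop)
          (hwc.continuousOn.log fun t ht => (hwpos t ht).ne')
      refine ((this.integrableOn_Icc).mono_set Ioc_subset_Icc_self).congr_fun (fun t ht => ?_)
        measurableSet_Ioc
      simp only [hv1 t ht.2]
    · rw [← hunion]
      refine IntegrableOn.union ?_ (hshift (fun t => x t ^ 2) _
        (fun t ht => by rw [hy2 t (le_of_lt ht)]) hp.integrableOn_sq)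
      have : ContinuousOn (fun t => Real.exp (-ρ * t) * y t ^ 2) (Icc 0 h) := by
        have := hyc.mono (Icc_subset_Ici_self : Icc 0 h ⊆ Ici 0)
        fun_prop
      exact (this.integrableOn_Icc).mono_set Ioc_subset_Icc_self
  refine ⟨v, y, hpath, ?_⟩
  rw [hpath.payoff_eq hh.le]
  congr 1
  · refine intervalIntegral.integral_congr fun t ht => ?_
    rw [uIcc_of_le hh.le] at ht
    rw [hv1 t ht.2, hy1 t ht.2, hwl t ht]
  · congr 1
    refine setIntegral_congr_fun measurableSet_Ioi fun t ht => ?_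
    have ht0 : (0 : ℝ) < t := ht
    beta_reduce
    rw [hv2 (t + h) (by linarith), hy2 (t + h) (by linarith), add_sub_cancel_right]

/-- The dynamic programming inequality along a linear piece. -/
theorem linear_prefix_le_pathValue {k h : ℝ} (hr : IsTame K r) (hK : 0 < K) (hρ : 0 < ρ)
    (hb : 0 < b) (hc : 0 < c) (hh : 0 < h) (hnn : ∀ t ∈ Icc 0 h, 0 ≤ x₀ + k * t)
    (hpos : ∀ t ∈ Icc 0 h, 0 < k + b * (x₀ + k * t) - r (x₀ + k * t)) :
    (∫ t in (0 : ℝ)..h, Real.exp (-ρ * t) *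
        (Real.log (k + b * (x₀ + k * t) - r (x₀ + k * t)) - c * (x₀ + k * t) ^ 2)) +
      Real.exp (-ρ * h) * pathValue ρ b c r (x₀ + k * h) ≤ pathValue ρ b c r x₀ := by
  have hx₀ : 0 ≤ x₀ := by simpa using hnn 0 ⟨le_rfl, hh.le⟩
  have he := Real.exp_pos (-ρ * h)
  rw [← le_sub_iff_add_le', ← le_div_iff₀' he]
  refine pathValue_le hr hK hρ hb hc (hnn h ⟨hh.le, le_rfl⟩) fun u x hp => ?_
  obtain ⟨v, y, hq, hJ⟩ := hp.exists_linear_prefix (c := c) hr hh hnn hpos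
  rw [le_div_iff₀' he, le_sub_iff_add_le', ← hJ]
  exact hq.payoff_le_pathValue hr hρ hc hx₀

theorem linear_prefix_le_pathValue_of_le {k h B : ℝ} (hr : IsTame K r) (hK : 0 < K)
    (hρ : 0 < ρ) (hb : 0 < b) (hc : 0 < c) (hh : 0 < h) (hnn : ∀ t ∈ Icc 0 h, 0 ≤ x₀ + k * t)
    (hpos : ∀ t ∈ Icc 0 h, 0 < k + b * (x₀ + k * t) - r (x₀ + k * t))
    (hB : ∀ t ∈ Icc 0 h,
      B ≤ Real.log (k + b * (x₀ + k * t) - r (x₀ + k * t)) - c * (x₀ + k * t) ^ 2) :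
    B * ((1 - Real.exp (-ρ * h)) / ρ) +
      Real.exp (-ρ * h) * pathValue ρ b c r (x₀ + k * h) ≤ pathValue ρ b c r x₀ := by
  refine le_trans (add_le_add_left ?_ _)
    (linear_prefix_le_pathValue hr hK hρ hb hc hh hnn hpos)
  have hrl := hr.continuousOn_comp (x := fun t => x₀ + k * t) (s := Icc 0 h) (by fun_prop) hnn
  rw [← integral_exp_neg_mul hρ h, mul_comm B, ← intervalIntegral.integral_mul_const]
  refine intervalIntegral.integral_mono_on hh.le
    (Continuous.intervalIntegrable (by fun_prop) _ _)
    (ContinuousOn.intervalIntegrable ?_) fun t ht => ?_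
  · rw [uIcc_of_le hh.le]
    refine ContinuousOn.mul (by fun_prop) (ContinuousOn.sub ?_ (by fun_prop))
    exact ContinuousOn.log (ContinuousOn.sub (by fun_prop) hrl) fun t ht => (hpos t ht).ne'
  · exact mul_le_mul_of_nonneg_left (hB t ht) (Real.exp_pos _).le

end Value

/-! ### Continuity of the value function. -/

/-- Apply ln y ≤ y - 1 to y = (1 + s)^θ, using subadditivity of the power θ. With θ small, the
square of ln(1 + d exp(M t)) is dominated by a multiple of d^(2θ) times an exponential weaker than
the discount. -/
theorem log_one_add_le_rpow_div {s θ : ℝ} (hs : 0 < s) (hθ : 0 < θ) (hθ1 : θ ≤ 1) :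
    Real.log (1 + s) ≤ s ^ θ / θ := by
  have h1 : (1 + s) ^ θ ≤ 1 + s ^ θ := by
    have := NNReal.rpow_add_le_add_rpow (1 : ℝ≥0) ⟨s, hs.le⟩ hθ.le hθ1
    rw [NNReal.one_rpow] at this
    exact_mod_cast this
  rw [le_div_iff₀ hθ, mul_comm, ← Real.log_rpow (by positivity)]
  have h2 := Real.log_le_sub_one_of_pos (show 0 < (1 + s) ^ θ by positivity)
  linarith

section Value

variable {ρ b c K x₀ : ℝ} {r u x : ℝ → ℝ}

/-- Raising the initial state: the state can be increased by a slowly growing `z` at the expense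
of a larger control. -/
theorem IsPath.exists_raised (hp : IsPath ρ b r x₀ u x) (hr : IsTame K r) (hK : 0 < K)
    (hρ : 0 < ρ) (hb : 0 < b) (hc : 0 < c) {z z' D : ℝ → ℝ} (hz : ∀ t, HasDerivAt z (z' t) t)
    (hz' : Continuous z') (hz0 : ∀ t, 0 ≤ z t) (hzK : ∀ t, K * min (z t) 1 ≤ z' t)
    {C : ℝ} (hzC : ∀ t, z' t ≤ C) (hzD : ∀ t, z t ^ 2 ≤ D t)
    (hD : IntegrableOn (fun t => Real.exp (-ρ * t) * D t) (Ioi 0)) {η : ℝ} (hη : 0 < η) :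
    ∃ v y, IsPath ρ b r (x₀ + z 0) v y ∧
      payoff ρ c u x - c * (η * (∫ t in Ioi (0 : ℝ), Real.exp (-ρ * t) * x t ^ 2) +
        (1 / η + 1) * ∫ t in Ioi (0 : ℝ), Real.exp (-ρ * t) * D t) ≤ payoff ρ c v y := by
  have hzc : Continuous z := continuous_iff_continuousAt.2 fun t => (hz t).continuousAt
  have hxa : Continuous fun t => x |t| :=
    hp.continuousOn.comp_continuous continuous_abs fun t => mem_Ici.2 (abs_nonneg t)
  have hxann : ∀ t, 0 ≤ x |t| := fun t => hp.nonneg _ (abs_nonneg t)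
  have hr1 : Continuous fun t => r (x |t|) := hr.continuous_comp hxa hxann
  have hr2 : Continuous fun t => r (x |t| + z t) :=
    hr.continuous_comp (hxa.add hzc) fun t => add_nonneg (hxann t) (hz0 t)
  -- The extra control that makes x + z a solution. It is nonnegative because z' ≥ K min(z, 1)
  -- dominates the increment of r, which is at most K z by the Lipschitz bound and at most K by
  -- boundedness.
  set w : ℝ → ℝ := fun t => z' t + b * z t - (r (x |t| + z t) - r (x |t|)) with hw
  have hwc : Continuous w := (hz'.add (hzc.const_mul b)).sub (hr2.sub hr1)
  have hdiff : ∀ a ≥ 0, ∀ d ≥ 0, |r (a + d) - r a| ≤ K * min d 1 := by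
    intro a ha d hd
    rw [mul_min_of_nonneg _ _ hK.le]
    refine le_min ?_ ?_
    · have := hr.lipschitz (a + d) (add_nonneg ha hd) a ha
      rwa [add_sub_cancel_left, abs_of_nonneg hd] at this
    · have h1 := hr.nonneg a ha
      have h2 := hr.le a ha
      have h3 := hr.nonneg (a + d) (add_nonneg ha hd)
      have h4 := hr.le (a + d) (add_nonneg ha hd)
      rw [abs_le]; constructor <;> linarith
  have hw0 : ∀ t, 0 ≤ w t := fun t => by
    have h1 := (abs_le.1 (hdiff _ (hxann t) _ (hz0 t))).2
    have h2 := mul_nonneg hb.le (hz0 t)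
    have := hzK t
    simp only [hw]; linarith
  have hwle : ∀ t, w t ≤ C + K + b * (1 + D t) := fun t => by
    have h1 := (abs_le.1 (hdiff _ (hxann t) _ (hz0 t))).1
    have h2 : z t ≤ 1 + D t := by nlinarith [hzD t, sq_nonneg (z t - 1)]
    have h3 := mul_le_mul_of_nonneg_left h2 hb.le
    have h4 := mul_le_mul_of_nonneg_left (min_le_right (z t) 1) hK.le
    have := hzC t
    simp only [hw]; linarith
  set v : ℝ → ℝ := fun t => u t + w t with hv
  set y : ℝ → ℝ := fun t => x t + z t with hy
  have huv : ∀ t ≥ 0, u t ≤ v t := fun t _ => le_add_of_nonneg_right (hw0 t)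
  have hlog1 : ∀ t ≥ 0, Real.log (u t) ≤ Real.log (v t) := fun t ht =>
    Real.log_le_log (hp.pos t ht) (huv t ht)
  have hlog2 : ∀ t ≥ 0, |Real.log (v t)| ≤ |Real.log (u t)| + w t := fun t ht => by
    have hu := hp.pos t ht
    have hw := hw0 t
    rw [abs_le]
    constructor
    · linarith [hlog1 t ht, neg_abs_le (Real.log (u t))]
    · rcases le_total 1 (u t) with h1 | h1
      · have h2 : v t ≤ u t * (1 + w t) := by simp only [hv]; nlinarith
        have h3 := Real.log_le_log (hu.trans_le (huv t ht)) h2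
        rw [Real.log_mul hu.ne' (by positivity)] at h3
        have h4 := Real.log_le_sub_one_of_pos (show 0 < 1 + w t by positivity)
        linarith [le_abs_self (Real.log (u t))]
      · have h3 := Real.log_le_sub_one_of_pos (hu.trans_le (huv t ht))
        simp only [hv] at h3 ⊢
        linarith [abs_nonneg (Real.log (u t))]
  have hzsq : IntegrableOn (fun t => Real.exp (-ρ * t) * z t ^ 2) (Ioi 0) := by
    refine Integrable.mono' hD (Continuous.aestronglyMeasurable (by fun_prop)) ?_
    refine ae_of_all _ fun t => ?_
    rw [Real.norm_of_nonneg (by positivity)]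
    exact mul_le_mul_of_nonneg_left (hzD t) (Real.exp_pos _).le
  have hyc : ContinuousOn y (Ici 0) := hp.continuousOn.add hzc.continuousOn
  have hvm : Measurable v := hp.measurable.add hwc.measurable
  -- Young's inequality with weight η: the cross term 2 x z costs a small multiple of x², which is
  -- controlled for near-optimal paths, and a large multiple of z², which is small with the
  -- displacement.
  have hsqle : ∀ t, y t ^ 2 ≤ x t ^ 2 + η * x t ^ 2 + (1 / η + 1) * D t := fun t => by
    have h1 : 2 * x t * z t ≤ η * x t ^ 2 + 1 / η * z t ^ 2 := by
      have : η * x t ^ 2 + 1 / η * z t ^ 2 - 2 * x t * z t = (η * x t - z t) ^ 2 / η := by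
        field_simp; ring
      have : 0 ≤ (η * x t - z t) ^ 2 / η := by positivity
      linarith
    have h2 := mul_le_mul_of_nonneg_left (hzD t) (show 0 ≤ 1 / η + 1 by positivity)
    simp only [hy]; nlinarith
  have hpath : IsPath ρ b r (x₀ + z 0) v y := by
    refine ⟨hvm, fun t ht => (hp.pos t ht).trans_le (huv t ht),
      fun T hT => (hp.intervalIntegrable T hT).add (hwc.intervalIntegrable _ _), hyc,
      fun t ht => add_nonneg (hp.nonneg t ht) (hz0 t), fun t ht => ?_, ?_, ?_⟩
    · have h1 : ∫ s in (0 : ℝ)..t, (v s - b * y s + r (y s)) =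
          ∫ s in (0 : ℝ)..t, ((u s - b * x s + r (x s)) + z' s) := by
        refine intervalIntegral.integral_congr fun s hs => ?_
        have hs0 : 0 ≤ s := uIcc_zero_subset_Ici ht hs
        simp only [hv, hy, hw, abs_of_nonneg hs0]
        ring
      rw [h1, intervalIntegral.integral_add (hp.intervalIntegrable_velocity hr ht)
        (hz'.intervalIntegrable _ _),
        intervalIntegral.integral_eq_sub_of_hasDerivAt (fun s _ => hz s)
          (hz'.intervalIntegrable _ _)]
      simp only [hy, hp.equation t ht]
      ring
    · have hbd : IntegrableOn (fun t => |Real.exp (-ρ * t) * Real.log (u t)| +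
          (Real.exp (-ρ * t) * (C + K + b) + b * (Real.exp (-ρ * t) * D t))) (Ioi 0) :=
        (Integrable.abs hp.integrableOn_log).add
          (((integrableOn_exp_neg_mul hρ).mul_const _).add (Integrable.const_mul hD b))
      refine Integrable.mono' hbd
        (Measurable.aestronglyMeasurable (by fun_prop)) ?_
      filter_upwards [ae_restrict_mem measurableSet_Ioi] with t ht
      have ht0 : 0 ≤ t := le_of_lt ht
      have he := Real.exp_pos (-ρ * t)
      rw [Real.norm_eq_abs, abs_mul, abs_mul, abs_of_pos he]
      have h1 := mul_le_mul_of_nonneg_left ((hlog2 t ht0).trans (add_le_add_right (hwle t) _))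
        he.le
      linarith
    · have hbd : IntegrableOn (fun t => 2 * (Real.exp (-ρ * t) * x t ^ 2) +
          2 * (Real.exp (-ρ * t) * z t ^ 2)) (Ioi 0) :=
        (Integrable.const_mul hp.integrableOn_sq 2).add (Integrable.const_mul hzsq 2)
      refine Integrable.mono' hbd (ContinuousOn.aestronglyMeasurable ?_ measurableSet_Ioi) ?_
      · have := hyc.mono Ioi_subset_Ici_self
        fun_prop
      · refine ae_of_all _ fun t => ?_
        have he := Real.exp_pos (-ρ * t)
        rw [Real.norm_of_nonneg (by positivity)]
        have h1 : y t ^ 2 ≤ 2 * x t ^ 2 + 2 * z t ^ 2 := by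
          simp only [hy]; nlinarith [sq_nonneg (x t - z t)]
        have := mul_le_mul_of_nonneg_left h1 he.le
        linarith
  refine ⟨v, y, hpath, ?_⟩
  have hI1 := (Integrable.const_mul hp.integrableOn_sq η)
  have hI2 := (Integrable.const_mul hD (1 / η + 1))
  have hI3 : IntegrableOn (fun t => c * (η * (Real.exp (-ρ * t) * x t ^ 2) +
      (1 / η + 1) * (Real.exp (-ρ * t) * D t))) (Ioi 0) := (hI1.add hI2).const_mul c
  have heq : payoff ρ c u x - c * (η * (∫ t in Ioi (0 : ℝ), Real.exp (-ρ * t) * x t ^ 2) +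
        (1 / η + 1) * ∫ t in Ioi (0 : ℝ), Real.exp (-ρ * t) * D t) =
      ∫ t in Ioi (0 : ℝ), (Real.exp (-ρ * t) * (Real.log (u t) - c * x t ^ 2) -
        c * (η * (Real.exp (-ρ * t) * x t ^ 2) + (1 / η + 1) * (Real.exp (-ρ * t) * D t))) := by
    rw [integral_sub hp.integrableOn_payoff hI3, integral_const_mul, integral_add hI1 hI2,
      integral_const_mul, integral_const_mul, payoff]
  rw [heq]
  refine setIntegral_mono_on (hp.integrableOn_payoff.sub hI3) hpath.integrableOn_payoff
    measurableSet_Ioi fun t ht => ?_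
  have h1 : Real.log (u t) - c * x t ^ 2 - c * (η * x t ^ 2 + (1 / η + 1) * D t) ≤
      Real.log (v t) - c * y t ^ 2 := by
    have := mul_le_mul_of_nonneg_left (hsqle t) hc.le
    linarith [hlog1 t (le_of_lt ht)]
  have := mul_le_mul_of_nonneg_left h1 (Real.exp_pos (-ρ * t)).le
  linarith

/-- Quantitative semicontinuity: raising the initial state costs little. -/
theorem payoff_le_pathValue_raised (hr : IsTame K r) (hK : 0 < K) (hρ : 0 < ρ) (hb : 0 < b)
    (hc : 0 < c) : ∃ θ > (0 : ℝ), ∃ A ≥ (0 : ℝ), ∀ x₀ ≥ 0, ∀ u x, IsPath ρ b r x₀ u x →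
      ∀ d > (0 : ℝ), ∀ η > (0 : ℝ),
      payoff ρ c u x - c * (η * (∫ t in Ioi (0 : ℝ), Real.exp (-ρ * t) * x t ^ 2) +
        (1 / η + 1) * (A * d ^ θ)) ≤ pathValue ρ b c r (x₀ + Real.log (1 + d)) := by
  -- The raising function is z = ln(1 + s) with s = d exp(M t). Since s/(1 + s) ≥ min(s, 1)/2, M ≥
  -- 2K gives z' ≥ K min(z, 1). Growth is only linear; an exponential z with rate K could outgrow
  -- the discount. The choice 2 M θ = ρ/2 makes s^(2θ) grow like exp(ρt/2).
  set M := 2 * K + ρ with hM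
  have hMpos : 0 < M := by positivity
  set θ := ρ / (4 * M) with hθ
  have hθpos : 0 < θ := by positivity
  have hθ1 : θ ≤ 1 := by rw [hθ, div_le_one (by positivity)]; linarith
  have hMθ : M * θ = ρ / 4 := by rw [hθ]; field_simp
  refine ⟨2 * θ, by positivity, 1 / θ ^ 2 * (1 / (ρ / 2)), by positivity, ?_⟩
  intro x₀ hx₀ u x hp d hd η hη
  set s : ℝ → ℝ := fun t => d * Real.exp (M * t) with hs
  have hspos : ∀ t, 0 < s t := fun t => mul_pos hd (Real.exp_pos _)
  have hsd : ∀ t, HasDerivAt s (M * s t) t := fun t => by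
    refine ((((hasDerivAt_id t).const_mul M).exp).const_mul d).congr_deriv ?_
    simp only [hs, id]; ring
  have hsc : Continuous s := by rw [hs]; fun_prop
  set D : ℝ → ℝ := fun t => d ^ (2 * θ) / θ ^ 2 * Real.exp (ρ / 2 * t) with hD
  have hDe : ∀ t, Real.exp (-ρ * t) * D t = d ^ (2 * θ) / θ ^ 2 * Real.exp (-(ρ / 2) * t) := by
    intro t
    simp only [hD]
    rw [mul_left_comm, ← Real.exp_add]
    congr 2; ring
  have hDint : IntegrableOn (fun t => Real.exp (-ρ * t) * D t) (Ioi 0) := by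
    simp only [hDe]
    exact (integrableOn_exp_neg_mul (half_pos hρ)).const_mul _
  have hDval : ∫ t in Ioi (0 : ℝ), Real.exp (-ρ * t) * D t =
      1 / θ ^ 2 * (1 / (ρ / 2)) * d ^ (2 * θ) := by
    simp only [hDe]
    rw [integral_const_mul, integral_Ioi_exp_neg_mul (half_pos hρ)]
    ring
  have h1s : ∀ t, 0 < 1 + s t := fun t => by have := hspos t; positivity
  have hz0 : ∀ t, 0 ≤ Real.log (1 + s t) := fun t =>
    Real.log_nonneg (by linarith [hspos t])
  have h3 : ∀ t, K * min (Real.log (1 + s t)) 1 ≤ M * s t / (1 + s t) := fun t => by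
    have hst := hspos t
    have hlog : Real.log (1 + s t) ≤ s t := by
      have := Real.log_le_sub_one_of_pos (h1s t); linarith
    rw [le_div_iff₀ (h1s t)]
    rcases le_total (s t) 1 with h | h
    · have h1 : K * min (Real.log (1 + s t)) 1 ≤ K * s t :=
        mul_le_mul_of_nonneg_left ((min_le_left _ _).trans hlog) hK.le
      have h2 : K * min (Real.log (1 + s t)) 1 * (1 + s t) ≤ K * s t * 2 :=
        mul_le_mul h1 (by linarith) (by linarith) (by positivity)
      have := mul_pos hρ hst
      rw [hM]; nlinarith
    · have h1 : K * min (Real.log (1 + s t)) 1 ≤ K * 1 :=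
        mul_le_mul_of_nonneg_left (min_le_right _ _) hK.le
      have h2 : K * min (Real.log (1 + s t)) 1 * (1 + s t) ≤ K * 1 * (2 * s t) :=
        mul_le_mul h1 (by linarith) (by linarith) (by positivity)
      have := mul_pos hρ hst
      rw [hM]; nlinarith
  have h4 : ∀ t, M * s t / (1 + s t) ≤ M := fun t => by
    rw [div_le_iff₀ (h1s t)]; nlinarith [hspos t]
  have h5 : ∀ t, Real.log (1 + s t) ^ 2 ≤ D t := fun t => by
    have h1 := log_one_add_le_rpow_div (hspos t) hθpos hθ1
    have h2 : s t ^ θ = d ^ θ * Real.exp (ρ / 4 * t) := by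
      simp only [hs]
      rw [Real.mul_rpow hd.le (Real.exp_pos _).le, ← Real.exp_mul]
      congr 2; rw [← hMθ]; ring
    have h3 := pow_le_pow_left₀ (hz0 t) h1 2
    refine h3.trans (le_of_eq ?_)
    rw [h2, div_pow, mul_pow, ← Real.exp_nat_mul, ← Real.rpow_natCast (d ^ θ) 2,
      ← Real.rpow_mul hd.le]
    simp only [hD]
    rw [show θ * ((2 : ℕ) : ℝ) = 2 * θ by push_cast; ring,
      show ((2 : ℕ) : ℝ) * (ρ / 4 * t) = ρ / 2 * t by push_cast; ring]
    ring
  obtain ⟨v, y, hq, hJ⟩ := hp.exists_raised (c := c) (z := fun t => Real.log (1 + s t))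
    (z' := fun t => M * s t / (1 + s t)) (D := D) (C := M) hr hK hρ hb hc
    (fun t => ((hsd t).const_add 1).log (h1s t).ne')
    (Continuous.div (by fun_prop) (by fun_prop) fun t => (h1s t).ne') hz0
    h3 h4 h5 hDint hη
  have h0 : x₀ + Real.log (1 + s 0) = x₀ + Real.log (1 + d) := by simp [hs]
  simp only [h0] at hq
  rw [hDval] at hJ
  exact hJ.trans (hq.payoff_le_pathValue hr hρ hc
    (add_nonneg hx₀ (Real.log_nonneg (by linarith))))

/-- Climb from x₁ to x₂ at speed K + 1. The control is at least 1, so ln u ≥ 0, and the climb takes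
a time proportional to x₂ - x₁. -/
theorem pathValue_sub_le (hr : IsTame K r) (hK : 0 < K) (hρ : 0 < ρ) (hb : 0 < b) (hc : 0 < c)
    (R : ℝ) : ∃ C ≥ 0, ∀ x₁ x₂, 0 ≤ x₁ → x₁ < x₂ → x₂ ≤ R →
      pathValue ρ b c r x₂ - pathValue ρ b c r x₁ ≤ C * (x₂ - x₁) := by
  set A := (ρ + b) ^ 2 / (2 * c * ρ) with hA
  have hA0 : 0 ≤ A := by positivity
  refine ⟨(c * R ^ 2 + ρ * A) / (K + 1), by positivity, fun x₁ x₂ h1 h12 h2 => ?_⟩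
  set h := (x₂ - x₁) / (K + 1) with hh
  have hhpos : 0 < h := div_pos (by linarith) (by linarith)
  have hkh : (K + 1) * h = x₂ - x₁ := by rw [hh]; field_simp
  have hx : ∀ t ∈ Icc 0 h, 0 ≤ x₁ + (K + 1) * t ∧ x₁ + (K + 1) * t ≤ R := fun t ht => by
    have := mul_le_mul_of_nonneg_left ht.2 (show 0 ≤ K + 1 by linarith)
    have := mul_nonneg (show 0 ≤ K + 1 by linarith) ht.1
    constructor <;> linarith
  have hone : ∀ t ∈ Icc 0 h,
      1 ≤ K + 1 + b * (x₁ + (K + 1) * t) - r (x₁ + (K + 1) * t) := fun t ht => by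
    have := hr.le _ (hx t ht).1
    have := mul_nonneg hb.le (hx t ht).1
    linarith
  have hG := linear_prefix_le_pathValue_of_le (B := -(c * R ^ 2)) hr hK hρ hb hc hhpos
    (fun t ht => (hx t ht).1) (fun t ht => one_pos.trans_le (hone t ht)) fun t ht => by
      have h3 := Real.log_nonneg (hone t ht)
      have h4 := mul_le_mul_of_nonneg_left (pow_le_pow_left₀ (hx t ht).1 (hx t ht).2 2) hc.le
      linarith
  rw [hkh, add_sub_cancel] at hG
  have he : 1 - Real.exp (-ρ * h) ≤ ρ * h := by
    have := Real.add_one_le_exp (-ρ * h); linarith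
  have he0 : 0 ≤ 1 - Real.exp (-ρ * h) := by
    have : Real.exp (-ρ * h) ≤ 1 := Real.exp_le_one_iff.2 (by nlinarith)
    linarith
  have hV := pathValue_le_const (b := b) hr hK hρ hb hc (h1.trans h12.le)
  have h5 : (1 - Real.exp (-ρ * h)) / ρ ≤ h := by rw [div_le_iff₀ hρ]; linarith
  have h6 := mul_le_mul_of_nonneg_left h5 (show 0 ≤ c * R ^ 2 by positivity)
  have h7 := mul_le_mul_of_nonneg_left hV he0
  have h8 := mul_le_mul_of_nonneg_right he hA0
  have h9 : (c * R ^ 2 + ρ * A) / (K + 1) * (x₂ - x₁) = (c * R ^ 2 + ρ * A) * h := by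
    rw [hh]; ring
  rw [h9]
  nlinarith

/-- Raise a near-optimal path from x₁ by x₂ - x₁ = ln(1 + d). First η is chosen against a bound on
the discounted integral of x² that is uniform for x₁ ≤ R, then the displacement is taken small
depending on η. -/
theorem pathValue_sub_le_of_lt (hr : IsTame K r) (hK : 0 < K) (hρ : 0 < ρ) (hb : 0 < b)
    (hc : 0 < c) {R ε : ℝ} (hR : 0 ≤ R) (hε : 0 < ε) : ∃ δ > 0, ∀ x₁ x₂, 0 ≤ x₁ → x₁ < x₂ →
      x₁ ≤ R → x₂ - x₁ < δ → pathValue ρ b c r x₁ - pathValue ρ b c r x₂ ≤ ε := by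
  obtain ⟨θ, hθ, A, hA, hmain⟩ := payoff_le_pathValue_raised hr hK hρ hb hc
  -- Upper bound on payoffs minus lower bound on V, plus 1 for the optimality gap; by
  -- `IsPath.payoff_le` it dominates c/2 times the discounted integral of x².
  set B := (ρ + b) ^ 2 / (2 * c * ρ) + c * (R + (K + 1) / b) ^ 2 / ρ + 1 with hB
  have hBpos : 0 < B := by positivity
  set η := ε / (3 * (2 * B)) with hη
  have hηpos : 0 < η := by positivity
  have hlim : Tendsto (fun h : ℝ => c * ((1 / η + 1) * (A * (Real.exp h - 1) ^ θ))) (𝓝 0)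
      (𝓝 0) := by
    have h1 : ContinuousAt (fun h : ℝ => (Real.exp h - 1) ^ θ) 0 :=
      ContinuousAt.rpow_const (f := fun h : ℝ => Real.exp h - 1) (by fun_prop) (Or.inr hθ.le)
    have h2 := (((h1.tendsto.const_mul A).const_mul (1 / η + 1)).const_mul c)
    simpa [Real.zero_rpow hθ.ne'] using h2
  obtain ⟨δ, hδ, hδ'⟩ := Metric.eventually_nhds_iff.1
    (hlim.eventually_lt_const (show 0 < ε / 3 by positivity))
  refine ⟨δ, hδ, fun x₁ x₂ h1 h12 h1R hd => ?_⟩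
  set e := min (ε / 3) 1 with he
  have hepos : 0 < e := lt_min (by positivity) one_pos
  obtain ⟨u, x, hp, hJ⟩ := exists_lt_payoff (c := c) hr hK hρ hb hc h1 hepos
  have hlow := le_pathValue (b := b) hr hK hρ hb hc h1
  have hlow' : c * (x₁ + (K + 1) / b) ^ 2 / ρ ≤ c * (R + (K + 1) / b) ^ 2 / ρ := by gcongr
  have hup := hp.payoff_le hr hρ hc h1
  set S := ∫ t in Ioi (0 : ℝ), Real.exp (-ρ * t) * x t ^ 2 with hS
  have he1 : e ≤ 1 := min_le_right _ _
  have he2 : e ≤ ε / 3 := min_le_left _ _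
  have hSB : c * S ≤ 2 * B := by
    have : c / 2 * S ≤ B := by rw [hB]; linarith
    linarith
  have hSε : c * (η * S) ≤ ε / 3 := by
    have := mul_le_mul_of_nonneg_left hSB hηpos.le
    have h3 : η * (2 * B) = ε / 3 := by rw [hη]; field_simp
    linarith
  have hdpos : 0 < Real.exp (x₂ - x₁) - 1 := by
    have := Real.add_one_lt_exp (show x₂ - x₁ ≠ 0 by linarith); linarith
  have hm := hmain x₁ h1 u x hp _ hdpos η hηpos
  rw [add_sub_cancel, Real.log_exp, add_sub_cancel] at hm
  have hδ3 := hδ' (y := x₂ - x₁) (by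
    rw [Real.dist_eq, sub_zero, abs_of_pos (by linarith)]; exact hd)
  linarith

theorem continuousOn_pathValue (hr : IsTame K r) (hK : 0 < K) (hρ : 0 < ρ) (hb : 0 < b)
    (hc : 0 < c) : ContinuousOn (pathValue ρ b c r) (Ici 0) := by
  rw [Metric.continuousOn_iff]
  intro x₀ hx₀ ε hε
  have hx₀' : (0 : ℝ) ≤ x₀ := hx₀
  obtain ⟨C, hC, h1⟩ := pathValue_sub_le hr hK hρ hb hc (x₀ + 1)
  obtain ⟨δ, hδ, h2⟩ := pathValue_sub_le_of_lt (R := x₀ + 1) hr hK hρ hb hc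
    (by positivity) (half_pos hε)
  refine ⟨min (min δ 1) (ε / (C + 1)), by positivity, fun x hx hd => ?_⟩
  rw [Real.dist_eq] at hd ⊢
  have hd1 : |x - x₀| < δ := hd.trans_le ((min_le_left _ _).trans (min_le_left _ _))
  have hd2 : |x - x₀| < 1 := hd.trans_le ((min_le_left _ _).trans (min_le_right _ _))
  have hd3 : |x - x₀| < ε / (C + 1) := hd.trans_le (min_le_right _ _)
  have hd4 : C * |x - x₀| < ε := by
    rw [lt_div_iff₀ (by positivity)] at hd3
    nlinarith [abs_nonneg (x - x₀)]
  rw [abs_lt]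
  rcases lt_trichotomy x x₀ with h | h | h
  · rw [abs_of_neg (sub_neg.2 h)] at hd1 hd2 hd4
    have h3 := h1 x x₀ hx h (by linarith)
    have h4 := h2 x x₀ hx h (by linarith) (by linarith)
    rw [neg_sub] at hd4
    constructor <;> linarith
  · subst h; simpa using hε
  · rw [abs_of_pos (sub_pos.2 h)] at hd1 hd2 hd4
    have h3 := h1 x₀ x hx₀ h (by linarith)
    have h4 := h2 x₀ x hx₀ h (by linarith) (by linarith)
    constructor <;> linarith

end Value

/-! ### Viscosity super- and subsolution properties. -/

theorem forall_lt_or_exists_first_hit {f : ℝ → ℝ} {T d : ℝ} (hf : ContinuousOn f (Icc 0 T))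
    (h0 : f 0 < d) : (∀ t ∈ Icc 0 T, f t < d) ∨
      ∃ τ ∈ Ioc 0 T, f τ = d ∧ ∀ t ∈ Icc 0 τ, f t ≤ d := by
  have hivt : ∀ t ∈ Icc 0 T, d ≤ f t → ∃ s ∈ Icc 0 t, f s = d := fun t ht hd =>
    intermediate_value_Icc ht.1 (hf.mono (Icc_subset_Icc_right ht.2)) ⟨h0.le, hd⟩
  by_cases h : ∀ t ∈ Icc 0 T, f t < d
  · exact Or.inl h
  push Not at h
  obtain ⟨t, ht, hd⟩ := h
  obtain ⟨s, hs, hsd⟩ := hivt t ht hd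
  have hcomp : IsCompact (Icc 0 T ∩ f ⁻¹' {d}) :=
    isCompact_Icc.of_isClosed_subset
      (hf.preimage_isClosed_of_isClosed isClosed_Icc isClosed_singleton) inter_subset_left
  obtain ⟨τ, ⟨hτ, hτd⟩, hmin⟩ := hcomp.exists_isLeast ⟨s, ⟨hs.1, hs.2.trans ht.2⟩, hsd⟩
  have hτd' : f τ = d := hτd
  have hτ0 : τ ≠ 0 := by
    rintro rfl; exact h0.ne hτd'
  refine Or.inr ⟨τ, ⟨lt_of_le_of_ne hτ.1 hτ0.symm, hτ.2⟩, hτd', fun a ha => ?_⟩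
  by_contra hcon
  push Not at hcon
  obtain ⟨e, he, hed⟩ := hivt a ⟨ha.1, ha.2.trans hτ.2⟩ hcon.le
  have h1 : τ ≤ e := hmin ⟨⟨he.1, he.2.trans (ha.2.trans hτ.2)⟩, hed⟩
  have h2 : a = τ := le_antisymm ha.2 (h1.trans he.2)
  rw [h2, hτd'] at hcon
  exact lt_irrefl _ hcon

theorem nonneg_of_hasDerivAt_of_eventually_nonneg {F : ℝ → ℝ} {F' : ℝ} (hF : HasDerivAt F F' 0)
    (h0 : F 0 = 0) (h : ∀ᶠ t in 𝓝[>] (0 : ℝ), 0 ≤ F t) : 0 ≤ F' := by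
  refine ge_of_tendsto hF.tendsto_slope_zero_right ?_
  filter_upwards [h, self_mem_nhdsWithin] with t ht ht0
  have ht0' : (0 : ℝ) < t := ht0
  rw [zero_add, h0, sub_zero, smul_eq_mul]
  positivity

section Value

variable {ρ b c K x₀ : ℝ} {r : ℝ → ℝ}

theorem one_sub_exp_div_le (hρ : 0 < ρ) (t : ℝ) : (1 - Real.exp (-ρ * t)) / ρ ≤ t := by
  rw [div_le_iff₀ hρ]
  have := Real.add_one_le_exp (-ρ * t)
  linarith

theorem exp_neg_mul_le_one (hρ : 0 < ρ) {t : ℝ} (ht : 0 ≤ t) : Real.exp (-ρ * t) ≤ 1 :=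
  Real.exp_le_one_iff.2 (by nlinarith)

/-- By continuity the running payoff along a short segment is within ε of its initial value.
Nonnegativity of the segment is assumed in place of x₀ > 0, so that upward segments from x₀ = 0 are
covered. -/
theorem eventually_linear_le_pathValue {k ε : ℝ} (hr : IsTame K r) (hK : 0 < K) (hρ : 0 < ρ)
    (hb : 0 < b) (hc : 0 < c) (hx₀ : 0 ≤ x₀) (hnn : ∀ᶠ t in 𝓝[≥] (0 : ℝ), 0 ≤ x₀ + k * t)
    (hpos : 0 < k + b * x₀ - r x₀) (hε : 0 < ε) :
    ∀ᶠ h in 𝓝[>] (0 : ℝ), (Real.log (k + b * x₀ - r x₀) - c * x₀ ^ 2 - ε) *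
      ((1 - Real.exp (-ρ * h)) / ρ) + Real.exp (-ρ * h) * pathValue ρ b c r (x₀ + k * h) ≤
      pathValue ρ b c r x₀ := by
  have hl : Continuous fun t : ℝ => x₀ + k * t := by fun_prop
  have hrl : Continuous fun t => r |x₀ + k * t| := hr.continuous_comp hl.abs fun t => abs_nonneg _
  have hw : Continuous fun t => k + b * (x₀ + k * t) - r |x₀ + k * t| :=
    (continuous_const.add (hl.const_mul b)).sub hrl
  have hw0 : k + b * (x₀ + k * 0) - r |x₀ + k * 0| = k + b * x₀ - r x₀ := by
    simp [abs_of_nonneg hx₀]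
  have e1 : ∀ᶠ t in 𝓝 (0 : ℝ), 0 < k + b * (x₀ + k * t) - r |x₀ + k * t| :=
    hw.continuousAt.eventually (lt_mem_nhds (by beta_reduce; rw [hw0]; exact hpos))
  have hG : ContinuousAt (fun t => Real.log (k + b * (x₀ + k * t) - r |x₀ + k * t|) -
      c * (x₀ + k * t) ^ 2) 0 := by
    refine ContinuousAt.sub ?_ (by fun_prop)
    exact hw.continuousAt.log (by rw [hw0]; exact hpos.ne')
  have e2 : ∀ᶠ t in 𝓝 (0 : ℝ), Real.log (k + b * x₀ - r x₀) - c * x₀ ^ 2 - ε <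
      Real.log (k + b * (x₀ + k * t) - r |x₀ + k * t|) - c * (x₀ + k * t) ^ 2 := by
    refine hG.eventually (lt_mem_nhds ?_)
    beta_reduce
    rw [hw0]; simp [hε]
  have e3 := (e1.and e2).filter_mono (nhdsWithin_le_nhds (s := Ici 0)) |>.and hnn
  obtain ⟨δ, hδ, hsub⟩ := mem_nhdsGE_iff_exists_Ico_subset.1 e3
  filter_upwards [Ioo_mem_nhdsGT (show (0 : ℝ) < δ from hδ)] with h hh
  have hall : ∀ t ∈ Icc 0 h, _ := fun t ht => hsub ⟨ht.1, ht.2.trans_lt hh.2⟩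
  refine linear_prefix_le_pathValue_of_le hr hK hρ hb hc hh.1 (fun t ht => (hall t ht).2)
    (fun t ht => ?_) fun t ht => ?_
  · have h1 := (hall t ht).1.1
    rwa [abs_of_nonneg (hall t ht).2] at h1
  · have h1 := (hall t ht).1.2
    rw [abs_of_nonneg (hall t ht).2] at h1
    exact h1.le

theorem isViscositySupersolution_pathValue (hr : IsTame K r) (hK : 0 < K) (hρ : 0 < ρ)
    (hb : 0 < b) (hc : 0 < c) :
    IsViscositySupersolution (hjb ρ b c r) (Ioi 0) (pathValue ρ b c r) := by
  intro φ hφ x₀ hx₀ hmin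
  have hx₀' : (0 : ℝ) < x₀ := hx₀
  set p := deriv φ x₀ with hp
  set V₀ := pathValue ρ b c r x₀ with hV₀
  have hφd : HasDerivAt φ p x₀ := (hφ.differentiable one_ne_zero x₀).hasDerivAt
  have hmin' : ∀ᶠ y in 𝓝 x₀, V₀ - φ x₀ ≤ pathValue ρ b c r y - φ y := by
    have := hmin
    rw [IsLocalMinOn, IsMinFilter, nhdsWithin_eq_nhds.2 (Ioi_mem_nhds hx₀')] at this
    exact this
  have key : ∀ w > 0, Real.log w - c * x₀ ^ 2 + p * (w - b * x₀ + r x₀) ≤ ρ * V₀ := by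
    intro w hw
    refine le_of_forall_pos_le_add fun ε hε => ?_
    set k := w - b * x₀ + r x₀ with hk
    set B := Real.log w - c * x₀ ^ 2 - ε with hB
    have hlin : Continuous fun t : ℝ => x₀ + k * t := by fun_prop
    have hlin0 : Tendsto (fun t : ℝ => x₀ + k * t) (𝓝 0) (𝓝 x₀) := by
      simpa using hlin.tendsto 0
    have hkw : k + b * x₀ - r x₀ = w := by rw [hk]; ring
    have hev := eventually_linear_le_pathValue (k := k) (ε := ε) hr hK hρ hb hc hx₀'.le
      ((hlin0.eventually (lt_mem_nhds hx₀')).filter_mono nhdsWithin_le_nhds |>.mono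
        fun t ht => ht.le) (by rw [hkw]; exact hw) hε
    rw [hkw] at hev
    have hE : HasDerivAt (fun t : ℝ => Real.exp (-ρ * t)) (-ρ) 0 := by
      simpa using ((hasDerivAt_id (0 : ℝ)).const_mul (-ρ)).exp
    have hφ0 : HasDerivAt (fun t : ℝ => φ (x₀ + k * t)) (p * k) 0 := by
      have h1 : HasDerivAt (fun t : ℝ => x₀ + k * t) k 0 := by
        simpa using ((hasDerivAt_id (0 : ℝ)).const_mul k).const_add x₀
      have h2 : HasDerivAt φ p (x₀ + k * 0) := by simpa using hφd
      exact h2.comp 0 h1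
    -- This function vanishes at 0 and is nonnegative just to the right, by dynamic programming and
    -- the minimum property; its derivative at 0 is ρ V₀ - B - p k.
    have hF := (((hE.const_sub 1).const_mul (V₀ - B / ρ))).sub
      (hE.mul (hφ0.sub_const (φ x₀)))
    have := nonneg_of_hasDerivAt_of_eventually_nonneg hF (by simp) (by
      filter_upwards [hev, (hlin0.eventually hmin').filter_mono nhdsWithin_le_nhds] with t h1 h2
      have h3 := mul_le_mul_of_nonneg_left h2 (Real.exp_pos (-ρ * t)).le
      have h4 : B * ((1 - Real.exp (-ρ * t)) / ρ) = B / ρ * (1 - Real.exp (-ρ * t)) := by ring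
      simp only [Pi.sub_apply, Pi.mul_apply]
      linarith)
    have hBρ : B / ρ * ρ = B := by field_simp
    simp only [mul_zero, Real.exp_zero, add_zero, sub_self, one_mul, neg_neg, zero_add] at this
    linarith
  have hpneg : p < 0 := by
    by_contra hcon
    push Not at hcon
    -- If p ≥ 0, the control w = exp(C + 1) makes the left side of `key` exceed ρ V₀ by at least 1.
    set C := ρ * V₀ + c * x₀ ^ 2 - p * (-b * x₀ + r x₀) with hC
    have h1 := key (Real.exp (C + 1)) (Real.exp_pos _)
    rw [Real.log_exp] at h1
    have h2 := mul_nonneg hcon (Real.exp_pos (C + 1)).le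
    linarith
  -- The maximiser of ln w + p w.
  have h1 := key (-p)⁻¹ (inv_pos.2 (neg_pos.2 hpneg))
  rw [Real.log_inv] at h1
  have h2 : p * (-p)⁻¹ = -1 := by
    rw [inv_neg, mul_neg, mul_inv_cancel₀ hpneg.ne]
  rw [hjb, if_pos hpneg]
  rw [EReal.coe_nonneg]
  linarith

/-- If the expression were positive, every path from x₀ would lose a fixed amount e compared with
V(x₀). Controls are unbounded, so a path may leave the neighbourhood arbitrarily fast; tilting the
slope to -p ± 2ε makes such an exit itself costly. Paths stay in [0,∞), so a maximum relative to
[0,∞) is enough, also at x₀ = 0. -/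
theorem isViscositySubsolution_pathValue (hr : IsTame K r) (hK : 0 < K) (hρ : 0 < ρ)
    (hb : 0 < b) (hc : 0 < c) :
    IsViscositySubsolution (hjb ρ b c r) (Ici 0) (pathValue ρ b c r) := by
  intro φ hφ x₀ hx₀ hmax
  have hx₀' : (0 : ℝ) ≤ x₀ := hx₀
  set p := deriv φ x₀ with hp
  set V₀ := pathValue ρ b c r x₀ with hV₀
  have hφd : HasDerivAt φ p x₀ := (hφ.differentiable one_ne_zero x₀).hasDerivAt
  rw [hjb]
  split_ifs with hpneg
  swap
  · exact bot_le
  rw [EReal.coe_nonpos]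
  by_contra hcon
  push Not at hcon
  set θ := ρ * V₀ - (r x₀ - b * x₀) * p + Real.log (-p) + c * x₀ ^ 2 + 1 with hθ
  have hq0 : 0 < -p := neg_pos.2 hpneg
  have e1 : ∀ᶠ q in 𝓝 (-p), 0 < q ∧
      q * (b * x₀ - r x₀) - c * x₀ ^ 2 - 1 - Real.log q < ρ * V₀ - θ / 2 := by
    have h1 : ContinuousAt
        (fun q => q * (b * x₀ - r x₀) - c * x₀ ^ 2 - 1 - Real.log q) (-p) :=
      ContinuousAt.sub (by fun_prop) (Real.continuousAt_log hq0.ne')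
    exact (lt_mem_nhds hq0).and (h1.tendsto.eventually (gt_mem_nhds (by rw [hθ]; linarith)))
  obtain ⟨ε, hε, hεq⟩ : ∃ ε > 0, ∀ q, |q - -p| ≤ 2 * ε → 0 < q ∧
      q * (b * x₀ - r x₀) - c * x₀ ^ 2 - 1 - Real.log q < ρ * V₀ - θ / 2 := by
    obtain ⟨δ, hδ, h⟩ := Metric.eventually_nhds_iff.1 e1
    exact ⟨δ / 4, by positivity, fun q hq => h (by rw [Real.dist_eq]; linarith)⟩
  have hHev : ∀ q, |q - -p| ≤ 2 * ε → ∀ᶠ y in 𝓝[Ici 0] x₀,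
      q * (ρ * (y - x₀) + b * y - r y) - c * y ^ 2 - 1 - Real.log q < ρ * V₀ - θ / 2 := by
    intro q hq
    have h1 : ContinuousWithinAt (fun y => q * (ρ * (y - x₀) + b * y - r y) - c * y ^ 2 - 1 -
        Real.log q) (Ici 0) x₀ := by
      have := hr.continuousOn x₀ hx₀
      fun_prop
    refine h1.tendsto.eventually (gt_mem_nhds ?_)
    have := (hεq q hq).2
    simpa using this
  have habs : |2 * ε| = 2 * ε := abs_of_pos (by positivity)
  have hq1 : |(-p - 2 * ε) - -p| ≤ 2 * ε := by
    rw [sub_sub_cancel_left, abs_neg, habs]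
  have hq2 : |(-p + 2 * ε) - -p| ≤ 2 * ε := by
    rw [add_sub_cancel_left, habs]
  have hVev : ∀ᶠ y in 𝓝[Ici 0] x₀,
      pathValue ρ b c r y ≤ V₀ + p * (y - x₀) + ε * |y - x₀| := by
    have h1 := (hasDerivAt_iff_isLittleO.1 hφd).def hε
    filter_upwards [h1.filter_mono nhdsWithin_le_nhds, hmax] with y h1 h2
    rw [Real.norm_eq_abs, Real.norm_eq_abs, smul_eq_mul] at h1
    have := (abs_le.1 h1).2
    linarith
  obtain ⟨δ, hδ, hball⟩ := Metric.mem_nhdsWithin_iff.1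
    ((hHev _ hq1).and ((hHev _ hq2).and hVev))
  set d := δ / 2 with hd
  have hdpos : 0 < d := half_pos hδ
  have hmem : ∀ y ≥ 0, |y - x₀| ≤ d → _ := fun y hy hyd =>
    hball (show y ∈ Metric.ball x₀ δ ∩ Ici 0 from
      ⟨by rw [Metric.mem_ball, Real.dist_eq]; linarith, hy⟩)
  set E := Real.exp (-ρ * 1) with hE
  have hEpos : 0 < E := Real.exp_pos _
  have hE1 : E < 1 := Real.exp_lt_one_iff.2 (by linarith)
  -- The first entry is the loss of a path that stays near x₀ for unit time; the second is the loss
  -- on exit at distance d, discounted by at most E.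
  set e := min (θ / 2 * ((1 - E) / ρ)) (E * (ε * d)) with he
  have hepos : 0 < e := lt_min (mul_pos (half_pos hcon) (div_pos (by linarith) hρ))
    (by positivity)
  have hall : ∀ u x, IsPath ρ b r x₀ u x → payoff ρ c u x ≤ V₀ - e := by
    intro u x hp
    have hτ : ∃ τ ∈ Ioc (0 : ℝ) 1, (∀ t ∈ Icc 0 τ, |x t - x₀| ≤ d) ∧
        (τ = 1 ∨ |x τ - x₀| = d) := by
      have hc : ContinuousOn (fun t => |x t - x₀|) (Icc 0 1) := by
        have := hp.continuousOn.mono (Icc_subset_Ici_self : Icc 0 1 ⊆ Ici (0 : ℝ))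
        fun_prop
      rcases forall_lt_or_exists_first_hit (d := d) hc (by simp [hp.initial, hdpos]) with h | h
      · exact ⟨1, ⟨one_pos, le_rfl⟩, fun t ht => (h t ht).le, Or.inl rfl⟩
      · obtain ⟨τ, hτ, h1, h2⟩ := h
        exact ⟨τ, hτ, h2, Or.inr h1⟩
    obtain ⟨τ, hτ, hstay, hend⟩ := hτ
    have hτd := hstay τ ⟨hτ.1.le, le_rfl⟩
    have hbound : payoff ρ c u x ≤ Real.exp (-ρ * τ) * (V₀ - ε * |x τ - x₀|) +
        (ρ * V₀ - θ / 2) * ((1 - Real.exp (-ρ * τ)) / ρ) := by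
      have hmτ := hmem _ (hp.nonneg τ hτ.1.le) hτd
      -- The sign of the tilt is chosen by the side on which the path ends, so that V(x τ) + q (x τ
      -- - x₀) ≤ V₀ - ε |x τ - x₀|.
      rcases le_total x₀ (x τ) with h | h
      · refine (hp.payoff_le_of_time_of_le hr hρ hc (hεq _ hq1).1 hτ.1.le fun t ht =>
          (hmem _ (hp.nonneg t ht.1) (hstay t ht)).1.le).trans (add_le_add_left ?_ _)
        refine mul_le_mul_of_nonneg_left ?_ (Real.exp_pos _).le
        have := hmτ.2.2
        rw [abs_of_nonneg (sub_nonneg.2 h)] at this ⊢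
        linarith
      · refine (hp.payoff_le_of_time_of_le hr hρ hc (hεq _ hq2).1 hτ.1.le fun t ht =>
          (hmem _ (hp.nonneg t ht.1) (hstay t ht)).2.1.le).trans (add_le_add_left ?_ _)
        refine mul_le_mul_of_nonneg_left ?_ (Real.exp_pos _).le
        have := hmτ.2.2
        rw [abs_of_nonpos (sub_nonpos.2 h)] at this ⊢
        linarith
    have hEτ1 := exp_neg_mul_le_one hρ hτ.1.le
    have hEτ : E ≤ Real.exp (-ρ * τ) := Real.exp_le_exp.2 (by nlinarith [hτ.2])
    have h1 : ρ * V₀ * ((1 - Real.exp (-ρ * τ)) / ρ) = V₀ * (1 - Real.exp (-ρ * τ)) := by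
      field_simp
    have h2 : 0 ≤ θ / 2 * ((1 - Real.exp (-ρ * τ)) / ρ) :=
      mul_nonneg (half_pos hcon).le (div_nonneg (by linarith) hρ.le)
    have h3 : 0 ≤ Real.exp (-ρ * τ) * (ε * |x τ - x₀|) := by positivity
    rcases hend with h | h
    · have h4 := min_le_left (θ / 2 * ((1 - E) / ρ)) (E * (ε * d))
      rw [h] at hbound h1 h2 h3
      rw [← hE] at hbound h1 h2 h3
      linarith
    · have h4 := min_le_right (θ / 2 * ((1 - E) / ρ)) (E * (ε * d))
      have h5 := mul_le_mul_of_nonneg_right hEτ (show 0 ≤ ε * d by positivity)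
      rw [h] at hbound
      linarith
  have := pathValue_le hr hK hρ hb hc hx₀' hall
  linarith

/-! ### Differentiability at the boundary point 0. -/

/-- Paths from `0` with nearly optimal payoff leave small neighbourhoods of `0` quickly. -/
theorem eventually_exists_hitting_time (hr : IsTame K r) (hρ : 0 < ρ) (hK : 0 < K)
    (hb : 0 < b) (hc : 0 < c) {δ : ℝ} (hδ : 0 < δ) :
    ∀ᶠ x in 𝓝[>] (0 : ℝ), ∀ u y, IsPath ρ b r 0 u y →
      pathValue ρ b c r 0 - 1 < payoff ρ c u y →
      ∃ τ ∈ Ioc 0 δ, y τ = x ∧ ∀ t ∈ Icc 0 τ, y t ≤ x := by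
  set V₀ := pathValue ρ b c r 0 with hV₀
  set A := (ρ + b) ^ 2 / (2 * c * ρ) with hA
  have hA0 : 0 ≤ A := by positivity
  set E := Real.exp (-ρ * δ) with hE
  have hE0 : 0 < E := Real.exp_pos _
  have hE1 : E < 1 := Real.exp_lt_one_iff.2 (by nlinarith)
  set w := (1 - E) / ρ with hw
  have hwpos : 0 < w := div_pos (by linarith) hρ
  -- Chosen so that the term -ln q, integrated with discount over [0, δ], contributes -(A - V₀ + 2).
  -- A path staying below x would then have payoff below V₀ - 1 once q x is small.
  set q := Real.exp ((A - V₀ + 2) / w) with hq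
  have hq0 : 0 < q := Real.exp_pos _
  have hlim : Tendsto (fun x : ℝ => E * (q * x) + q * ((ρ + b) * x) * w) (𝓝[>] 0) (𝓝 0) := by
    have : Continuous fun x : ℝ => E * (q * x) + q * ((ρ + b) * x) * w := by fun_prop
    simpa using (this.tendsto 0).mono_left (nhdsWithin_le_nhds (s := Ioi 0))
  filter_upwards [hlim.eventually_lt_const one_pos, self_mem_nhdsWithin] with x hx hx0 u y hp hJ
  have hx0' : (0 : ℝ) < x := hx0
  rcases forall_lt_or_exists_first_hit (d := x)
    (hp.continuousOn.mono (Icc_subset_Ici_self : Icc 0 δ ⊆ Ici (0 : ℝ)))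
    (by rw [hp.initial]; exact hx0') with h | h
  · exfalso
    have hB := hp.payoff_le_of_time_of_le (B := q * ((ρ + b) * x) - 1 - Real.log q) hr hρ hc hq0
      hδ.le fun t ht => by
        have h1 := hp.nonneg t ht.1
        have h2 := hr.nonneg _ h1
        have h3 : ρ * (y t - 0) + b * y t - r (y t) ≤ (ρ + b) * x := by
          have := mul_le_mul_of_nonneg_left (h t ht).le (show 0 ≤ ρ + b by linarith)
          linarith
        have h4 := mul_le_mul_of_nonneg_left h3 hq0.le
        have h5 : 0 ≤ c * y t ^ 2 := by positivity
        linarith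
    have h1 : pathValue ρ b c r (y δ) ≤ A :=
      pathValue_le_const hr hK hρ hb hc (hp.nonneg δ hδ.le)
    have h2 := mul_le_mul_of_nonneg_left h1 hE0.le
    have h3 := mul_le_mul_of_nonneg_right hE1.le hA0
    have h4 := mul_le_mul_of_nonneg_left (mul_le_mul_of_nonneg_left
      (h δ ⟨hδ.le, le_rfl⟩).le hq0.le) hE0.le
    have h5 : Real.log q * w = A - V₀ + 2 := by
      rw [hq, Real.log_exp]; field_simp
    rw [← hE, ← hw] at hB
    rw [sub_zero] at hB
    linarith
  · exact h

/-- The slope q solves ln q + ρ V₀ + 1 = 0. The upper estimate follows the segment of speed 1/q from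
0 to x. The lower one applies the tangent bound with this q to a near-optimal path until it first
reaches x: there the integrand is at most ρ V₀ + O(x), and the elapsed time is at most δ, so the
error is O(δ x). -/
theorem hasDerivWithinAt_pathValue_zero (hr : IsTame K r) (hr0 : r 0 = 0) (hK : 0 < K)
    (hρ : 0 < ρ) (hb : 0 < b) (hc : 0 < c) :
    HasDerivWithinAt (pathValue ρ b c r)
      (-Real.exp (-(1 + ρ * pathValue ρ b c r 0))) (Ici 0) 0 := by
  set V₀ := pathValue ρ b c r 0 with hV₀
  set q := Real.exp (-(1 + ρ * V₀)) with hq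
  have hq0 : 0 < q := Real.exp_pos _
  have hlogq : Real.log q = -(1 + ρ * V₀) := Real.log_exp _
  have hupper : ∀ ε > 0, ∀ᶠ x in 𝓝[>] (0 : ℝ),
      pathValue ρ b c r x - V₀ + q * x ≤ ε * x := by
    intro ε hε
    set e := min (ε / q) 1 with he
    have he0 : 0 < e := lt_min (by positivity) one_pos
    have heq : e * q ≤ ε := by
      have := mul_le_mul_of_nonneg_right (min_le_left (ε / q) 1) hq0.le
      rwa [div_mul_cancel₀ _ hq0.ne'] at this
    have hk : q⁻¹ + b * 0 - r 0 = q⁻¹ := by rw [hr0]; ring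
    -- Speed 1/q maximises ln u - q u, and x is reached at time q x.
    have hev := eventually_linear_le_pathValue (c := c) (x₀ := 0) (k := q⁻¹) (ε := e) hr hK hρ hb hc
      le_rfl (by
        filter_upwards [self_mem_nhdsWithin] with t ht
        have : (0 : ℝ) ≤ t := ht
        positivity) (by rw [hk]; positivity) he0
    rw [hk, Real.log_inv, hlogq] at hev
    have hscale : Tendsto (fun x : ℝ => q * x) (𝓝[>] 0) (𝓝[>] 0) := by
      refine tendsto_nhdsWithin_iff.2 ⟨?_, ?_⟩
      · have : Continuous fun x : ℝ => q * x := by fun_prop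
        simpa using (this.tendsto 0).mono_left (nhdsWithin_le_nhds (s := Ioi 0))
      · filter_upwards [self_mem_nhdsWithin] with x hx
        exact mul_pos hq0 hx
    filter_upwards [hscale.eventually hev, self_mem_nhdsWithin] with x hx hx0
    have hx0' : (0 : ℝ) < x := hx0
    rw [inv_mul_cancel_left₀ hq0.ne', zero_add] at hx
    set E := Real.exp (-ρ * (q * x)) with hE
    have hE0 : 0 < E := Real.exp_pos _
    have h1 : ρ * V₀ * ((1 - E) / ρ) = V₀ * (1 - E) := by field_simp
    have h2 : E * (pathValue ρ b c r x - V₀) ≤ -((1 - e) * ((1 - E) / ρ)) := by linarith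
    have h3 : E * (q * x) ≤ (1 - E) / ρ := by
      rw [le_div_iff₀ hρ]
      have h4 := Real.add_one_le_exp (ρ * (q * x))
      have h5 : E * Real.exp (ρ * (q * x)) = 1 := by
        rw [hE, ← Real.exp_add]; simp
      have := mul_le_mul_of_nonneg_left h4 hE0.le
      linarith
    have h6 := mul_le_mul_of_nonneg_left h3 (sub_nonneg.2 (min_le_right (ε / q) 1))
    have h7 : E * (pathValue ρ b c r x - V₀) ≤ E * (-((1 - e) * (q * x))) := by
      rw [← he] at h6; linarith
    have h8 := le_of_mul_le_mul_left h7 hE0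
    have h9 := mul_le_mul_of_nonneg_right heq hx0'.le
    linarith
  have hlower : ∀ ε > 0, ∀ᶠ x in 𝓝[>] (0 : ℝ),
      -(ε * x) ≤ pathValue ρ b c r x - V₀ + q * x := by
    intro ε hε
    set C := Real.exp ρ * (1 + q * (ρ + b)) with hC
    have hCpos : 0 < C := by positivity
    set δ := min 1 (ε / C) with hδ
    have hδ0 : 0 < δ := lt_min one_pos (by positivity)
    have hδC : C * δ ≤ ε := by
      have := mul_le_mul_of_nonneg_left (min_le_right 1 (ε / C)) hCpos.le
      rwa [mul_div_cancel₀ _ hCpos.ne'] at this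
    filter_upwards [eventually_exists_hitting_time (c := c) hr hρ hK hb hc hδ0,
      self_mem_nhdsWithin] with x hx hx0
    have hx0' : (0 : ℝ) < x := hx0
    -- A gap of at most 1 is needed for the hitting time; a gap of at most δ x keeps the error a
    -- small multiple of x.
    obtain ⟨u, y, hp, hJ⟩ := exists_lt_payoff (c := c) hr hK hρ hb hc le_rfl
      (lt_min one_pos (mul_pos hδ0 hx0'))
    rw [← hV₀] at hJ
    obtain ⟨τ, hτ, hyτ, hyle⟩ := hx u y hp
      (lt_of_le_of_lt (sub_le_sub_left (min_le_left _ _) _) hJ)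
    have hB := hp.payoff_le_of_time_of_le (B := q * ((ρ + b) * x) + ρ * V₀) hr hρ hc hq0
      hτ.1.le fun t ht => by
        have h1 := hp.nonneg t ht.1
        have h2 := hr.nonneg _ h1
        have h3 : ρ * (y t - 0) + b * y t - r (y t) ≤ (ρ + b) * x := by
          have := mul_le_mul_of_nonneg_left (hyle t ht) (show 0 ≤ ρ + b by linarith)
          linarith
        have h4 := mul_le_mul_of_nonneg_left h3 hq0.le
        have h5 : 0 ≤ c * y t ^ 2 := by positivity
        rw [hlogq]
        linarith
    rw [hyτ, sub_zero] at hB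
    set E := Real.exp (-ρ * τ) with hE
    have hE0 : 0 < E := Real.exp_pos _
    have h1 : ρ * V₀ * ((1 - E) / ρ) = V₀ * (1 - E) := by field_simp
    have h2 : (1 - E) / ρ ≤ δ := (one_sub_exp_div_le hρ τ).trans hτ.2
    have h3 := mul_le_mul_of_nonneg_left h2 (show 0 ≤ q * ((ρ + b) * x) by positivity)
    have h4 := min_le_right 1 (δ * x)
    have h5 : -((1 + q * (ρ + b)) * δ * x) ≤ E * (pathValue ρ b c r x - V₀ + q * x) := by
      linarith
    have h6 : 1 ≤ E * Real.exp ρ := by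
      rw [hE, ← Real.exp_add]
      refine Real.one_le_exp ?_
      have : τ ≤ 1 := hτ.2.trans (min_le_left _ _)
      nlinarith
    have h7 : 0 ≤ (1 + q * (ρ + b)) * δ * x := by positivity
    have h8 := mul_le_mul_of_nonneg_right h6 h7
    have h9 : E * (-(C * δ * x)) ≤ E * (pathValue ρ b c r x - V₀ + q * x) := by
      refine le_trans ?_ h5
      rw [hC]
      linarith
    have h10 := le_of_mul_le_mul_left h9 hE0
    have h11 := mul_le_mul_of_nonneg_right hδC hx0'.le
    linarith
  rw [hasDerivWithinAt_iff_isLittleO, Asymptotics.isLittleO_iff]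
  intro ε hε
  rw [← Ioi_insert, nhdsWithin_insert, eventually_sup]
  refine ⟨by simp, ?_⟩
  filter_upwards [hupper ε hε, hlower ε hε, self_mem_nhdsWithin] with x h1 h2 hx
  have hx0 : (0 : ℝ) < x := hx
  rw [sub_zero, Real.norm_eq_abs, Real.norm_of_nonneg hx0.le, smul_eq_mul, abs_le]
  constructor <;> linarith

end Value

/-! ### Uniqueness of the state and reduction of random controls to deterministic ones. -/

/-- The control cancels in the difference of two solutions, which therefore has a continuous right
derivative even though u is only locally integrable; Grönwall's inequality applies with constant b +
K. -/
theorem eqOn_of_equation {b K x₀ : ℝ} {r u x y : ℝ → ℝ} (hr : IsTame K r) (hb : 0 < b)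
    (hu : ∀ T ≥ 0, IntervalIntegrable u volume 0 T)
    (hxc : ContinuousOn x (Ici 0)) (hx0 : ∀ t ≥ 0, 0 ≤ x t)
    (hx : ∀ t ≥ 0, x t = x₀ + ∫ s in (0 : ℝ)..t, (u s - b * x s + r (x s)))
    (hyc : ContinuousOn y (Ici 0)) (hy0 : ∀ t ≥ 0, 0 ≤ y t)
    (hy : ∀ t ≥ 0, y t = x₀ + ∫ s in (0 : ℝ)..t, (u s - b * y s + r (y s))) :
    ∀ t ≥ 0, x t = y t := by
  intro T hT
  have hrx : ContinuousOn (fun t => r (x t)) (Ici 0) := hr.continuousOn_comp hxc hx0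
  have hry : ContinuousOn (fun t => r (y t)) (Ici 0) := hr.continuousOn_comp hyc hy0
  set g : ℝ → ℝ := fun s => -b * (x s - y s) + (r (x s) - r (y s)) with hg
  have hgc : ContinuousOn g (Ici 0) :=
    ((hxc.sub hyc).const_mul (-b)).add (hrx.sub hry)
  have hint : ∀ t ≥ 0, x t - y t = ∫ s in (0 : ℝ)..t, g s := by
    intro t ht
    have hs := uIcc_zero_subset_Ici ht
    have h1 : ∀ z : ℝ → ℝ, ContinuousOn z (Ici 0) → ContinuousOn (fun t => r (z t)) (Ici 0) →
        IntervalIntegrable (fun s => u s - b * z s + r (z s)) volume 0 t := fun z hz hrz =>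
      ((hu t ht).sub ((hz.mono hs).intervalIntegrable.const_mul b)).add
        (hrz.mono hs).intervalIntegrable
    rw [hx t ht, hy t ht, add_sub_add_left_eq_sub,
      ← intervalIntegral.integral_sub (h1 x hxc hrx) (h1 y hyc hry)]
    refine intervalIntegral.integral_congr fun s _ => ?_
    simp only [hg]; ring
  have hmain := eq_zero_of_abs_deriv_le_mul_abs_self_of_eq_zero_right (f := fun t => x t - y t)
    (f' := g) (K := b + K) (a := 0) (b := T) ((hxc.sub hyc).mono Icc_subset_Ici_self) ?_
    (by simp [hx 0 le_rfl, hy 0 le_rfl]) ?_ T ⟨hT, le_rfl⟩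
  · exact sub_eq_zero.1 hmain
  · intro t ht
    have hsub : Ici t ⊆ Ici (0 : ℝ) := Ici_subset_Ici.2 ht.1
    have hd : HasDerivWithinAt (fun t => ∫ s in (0 : ℝ)..t, g s) (g t) (Ici t) t := by
      refine intervalIntegral.integral_hasDerivWithinAt_right
        (hgc.mono (uIcc_zero_subset_Ici ht.1)).intervalIntegrable ?_
        ((hgc t ht.1).mono (Ioi_subset_Ici_self.trans hsub))
      exact (hgc.mono (Ioi_subset_Ici_self.trans hsub)).stronglyMeasurableAtFilter_nhdsWithin
        measurableSet_Ioi t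
    exact hd.congr (fun s hs => hint s (hsub hs)) (hint t ht.1)
  · intro t ht
    have h1 := hr.lipschitz _ (hx0 t ht.1) _ (hy0 t ht.1)
    simp only [Real.norm_eq_abs, hg]
    calc |-b * (x t - y t) + (r (x t) - r (y t))|
        ≤ |-b * (x t - y t)| + |r (x t) - r (y t)| := abs_add_le _ _
      _ ≤ b * |x t - y t| + K * |x t - y t| := by
          rw [abs_mul, abs_neg, abs_of_pos hb]; linarith
      _ = (b + K) * |x t - y t| := by ring

section Lift

variable {Ω : Type*} {mΩ : MeasurableSpace Ω} (P : Measure Ω) (ℱ : Filtration ℝ≥0 mΩ)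
  {ρ b c K x₀ : ℝ} {r u x : ℝ → ℝ}

theorem IsPath.isSolution (hp : IsPath ρ b r x₀ u x) :
    IsSolution P ℱ b r x₀ (fun t _ => u t) (fun t _ => x t) :=
  ⟨fun _ => measurable_const, ae_of_all _ fun _ => hp.continuousOn, ae_of_all _ fun _ => hp.nonneg,
    ae_of_all _ fun _ => hp.equation⟩

theorem integrableOn_Ici_zero_iff {f : ℝ → ℝ} :
    IntegrableOn f (Ici 0) ↔ IntegrableOn f (Ioi 0) :=
  integrableOn_Ici_iff_integrableOn_Ioi

theorem lintegral_ofReal_lt_top_of_integrableOn {f : ℝ → ℝ} (hf : IntegrableOn f (Ioi 0)) :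
    ∫⁻ t in Ici (0 : ℝ), ENNReal.ofReal (f t) < ⊤ :=
  Integrable.lintegral_lt_top (integrableOn_Ici_zero_iff.2 hf)

theorem IsPath.isAdmissible [IsProbabilityMeasure P] (hp : IsPath ρ b r x₀ u x)
    (hr : IsTame K r) (hb : 0 < b) : IsAdmissible P ℱ ρ b r x₀ (fun t _ => u t) := by
  refine ⟨fun _ => measurable_const, ?_, fun t ht _ => hp.pos t ht,
    ae_of_all _ fun _ => hp.intervalIntegrable, ?_, ⟨_, hp.isSolution P ℱ⟩, fun y z hy hz => ?_⟩
  · exact hp.measurable.comp (measurable_subtype_coe.comp measurable_fst)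
  · rw [lintegral_const, measure_univ, mul_one]
    exact lintegral_ofReal_lt_top_of_integrableOn hp.integrableOn_log
  · filter_upwards [hy.continuous, hy.nonneg, hy.equation, hz.continuous, hz.nonneg, hz.equation]
      with ω h1 h2 h3 h4 h5 h6
    exact eqOn_of_equation hr hb hp.intervalIntegrable h1 h2 h3 h4 h5 h6

theorem IsPath.benefit_eq [IsProbabilityMeasure P] (hp : IsPath ρ b r x₀ u x) :
    benefit P ρ c (fun t _ => u t) (fun t _ => x t) = (payoff ρ c u x : EReal) := by
  have hf := hp.integrableOn_payoff (c := c)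
  have h1 := (lintegral_ofReal_lt_top_of_integrableOn hf).ne
  have h2 := (lintegral_ofReal_lt_top_of_integrableOn hf.neg).ne
  simp only [Pi.neg_apply] at h2
  rw [benefit, lintegral_const, lintegral_const, measure_univ, mul_one, mul_one, payoff,
    ← integral_Ici_eq_integral_Ioi,
    integral_eq_lintegral_pos_part_sub_lintegral_neg_part
      (integrableOn_Ici_zero_iff.2 hf), EReal.coe_sub,
    EReal.coe_ennreal_toReal h1, EReal.coe_ennreal_toReal h2]

/-- The negative part of g is dominated by that of f. With f the discounted payoff and g the
discounted logarithm, a payoff other than `-∞` forces the logarithm to be integrable. -/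
theorem integrable_of_le_of_lintegral_lt_top {α : Type*} {mα : MeasurableSpace α}
    {μ : Measure α} {f g : α → ℝ} (hg : AEStronglyMeasurable g μ) (hfg : ∀ a, f a ≤ g a)
    (h1 : ∫⁻ a, ENNReal.ofReal (g a) ∂μ < ⊤) (h2 : ∫⁻ a, ENNReal.ofReal (-f a) ∂μ < ⊤) :
    Integrable g μ := by
  refine ⟨hg, (hasFiniteIntegral_iff_norm g).2 ?_⟩
  refine lt_of_le_of_lt ?_ (ENNReal.add_lt_top.2 ⟨h1, h2⟩)
  rw [← lintegral_add_left' hg.aemeasurable.ennreal_ofReal]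
  refine lintegral_mono fun a => ?_
  rcases le_total 0 (g a) with h | h
  · rw [Real.norm_of_nonneg h]; exact le_self_add
  · rw [Real.norm_of_nonpos h]
    exact (ENNReal.ofReal_le_ofReal (neg_le_neg (hfg a))).trans le_add_self

/-- The payoff bound for a single trajectory, with values `-∞` allowed. -/
theorem lintegral_payoff_le (hr : IsTame K r) (hρ : 0 < ρ) (hc : 0 < c)
    (hx₀ : 0 ≤ x₀) (hm : Measurable u) (hpos : ∀ t ≥ 0, 0 < u t)
    (hu : ∀ T ≥ 0, IntervalIntegrable u volume 0 T)
    (hlog : ∫⁻ t in Ici (0 : ℝ), ENNReal.ofReal (Real.exp (-ρ * t) * Real.log (u t)) < ⊤)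
    (hxc : ContinuousOn x (Ici 0)) (hx0 : ∀ t ≥ 0, 0 ≤ x t)
    (hx : ∀ t ≥ 0, x t = x₀ + ∫ s in (0 : ℝ)..t, (u s - b * x s + r (x s))) :
    (∫⁻ t in Ici (0 : ℝ), ENNReal.ofReal (Real.exp (-ρ * t) * (Real.log (u t) - c * x t ^ 2))) +
      ENNReal.ofReal (-pathValue ρ b c r x₀) ≤
    (∫⁻ t in Ici (0 : ℝ),
      ENNReal.ofReal (-(Real.exp (-ρ * t) * (Real.log (u t) - c * x t ^ 2)))) +
      ENNReal.ofReal (pathValue ρ b c r x₀) := by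
  set V := pathValue ρ b c r x₀ with hV
  set f : ℝ → ℝ := fun t => Real.exp (-ρ * t) * (Real.log (u t) - c * x t ^ 2) with hf
  set g : ℝ → ℝ := fun t => Real.exp (-ρ * t) * Real.log (u t) with hg
  have hfg : ∀ t, f t ≤ g t := fun t => by
    have : 0 ≤ Real.exp (-ρ * t) * (c * x t ^ 2) := by positivity
    simp only [hf, hg]; linarith
  rcases eq_or_ne (∫⁻ t in Ici (0 : ℝ), ENNReal.ofReal (-f t)) ⊤ with htop | htop
  · rw [htop, top_add]; exact le_top
  have hα : ∫⁻ t in Ici (0 : ℝ), ENNReal.ofReal (f t) < ⊤ :=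
    (lintegral_mono fun t => ENNReal.ofReal_le_ofReal (hfg t)).trans_lt hlog
  have hgm : AEStronglyMeasurable g (volume.restrict (Ici 0)) :=
    Measurable.aestronglyMeasurable (by fun_prop)
  have hsm : AEStronglyMeasurable (fun t => Real.exp (-ρ * t) * (c * x t ^ 2))
      (volume.restrict (Ici 0)) :=
    ContinuousOn.aestronglyMeasurable (by fun_prop) measurableSet_Ici
  have hfm : AEStronglyMeasurable f (volume.restrict (Ici 0)) := by
    refine (hgm.sub hsm).congr (ae_of_all _ fun t => ?_)
    simp only [hf, hg, Pi.sub_apply]; ring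
  have hgi : IntegrableOn g (Ici 0) :=
    integrable_of_le_of_lintegral_lt_top hgm hfg hlog htop.lt_top
  have hfi : IntegrableOn f (Ici 0) :=
    integrable_of_le_of_lintegral_lt_top hfm (fun _ => le_rfl) hα htop.lt_top
  have hp : IsPath ρ b r x₀ u x := by
    refine ⟨hm, hpos, hu, hxc, hx0, hx, integrableOn_Ici_zero_iff.1 hgi,
      integrableOn_Ici_zero_iff.1 ?_⟩
    -- The discounted square of the state is (g - f)/c, hence integrable.
    refine (Integrable.const_mul (hgi.sub hfi) c⁻¹).congr (ae_of_all _ fun t => ?_)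
    simp only [hf, hg, Pi.sub_apply]
    field_simp
    ring
  have hJ := hp.payoff_le_pathValue hr hρ hc hx₀
  rw [payoff, ← integral_Ici_eq_integral_Ioi,
    integral_eq_lintegral_pos_part_sub_lintegral_neg_part hfi] at hJ
  rw [← ENNReal.ofReal_toReal hα.ne, ← ENNReal.ofReal_toReal htop]
  rw [← hV] at hJ
  rcases le_total 0 V with h | h
  · rw [ENNReal.ofReal_of_nonpos (neg_nonpos.2 h), add_zero,
      ← ENNReal.ofReal_add ENNReal.toReal_nonneg h]
    exact ENNReal.ofReal_le_ofReal (by linarith)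
  · rw [ENNReal.ofReal_of_nonpos h, add_zero,
      ← ENNReal.ofReal_add ENNReal.toReal_nonneg (neg_nonneg.2 h)]
    exact ENNReal.ofReal_le_ofReal (by linarith)

/-- The deterministic bound holds along almost every trajectory. Stated additively in [0,∞], with
positive and negative parts on opposite sides, it can be integrated over ω without subtracting
infinities. -/
theorem benefit_le_pathValue [IsProbabilityMeasure P] (hr : IsTame K r) (hρ : 0 < ρ)
    (hc : 0 < c) (hx₀ : 0 ≤ x₀) {u x : ℝ → Ω → ℝ} (hu : IsAdmissible P ℱ ρ b r x₀ u)
    (hx : IsSolution P ℱ b r x₀ u x) : benefit P ρ c u x ≤ (pathValue ρ b c r x₀ : EReal) := by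
  set V := pathValue ρ b c r x₀ with hV
  -- Extending u to negative times by its value at 0 gives joint measurability on the whole line.
  set v : ℝ → Ω → ℝ := fun t => u (t.toNNReal : ℝ≥0) with hv
  have hvu : ∀ t ≥ 0, v t = u t := fun t ht => by simp only [hv, Real.coe_toNNReal t ht]
  have hvm : Measurable fun p : Ω × ℝ => v p.2 p.1 :=
    hu.measurable.comp ((measurable_real_toNNReal.comp measurable_snd).prodMk measurable_fst)
  have hcongr : ∀ F : ℝ → ℝ → ℝ≥0∞, ∀ ω, ∫⁻ t in Ici (0 : ℝ), F t (u t ω) =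
      ∫⁻ t in Ici (0 : ℝ), F t (v t ω) := fun F ω =>
    setLIntegral_congr_fun measurableSet_Ici fun t ht => by rw [hvu t ht]
  have hlogm : Measurable fun ω => ∫⁻ t in Ici (0 : ℝ),
      ENNReal.ofReal (Real.exp (-ρ * t) * Real.log (v t ω)) := by
    have : Measurable fun p : Ω × ℝ =>
        ENNReal.ofReal (Real.exp (-ρ * p.2) * Real.log (v p.2 p.1)) :=
      ((by fun_prop : Measurable fun p : Ω × ℝ => Real.exp (-ρ * p.2)).mul
        hvm.log).ennreal_ofReal
    exact this.lintegral_prod_right'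
  have hlog : ∫⁻ ω, (∫⁻ t in Ici (0 : ℝ),
      ENNReal.ofReal (Real.exp (-ρ * t) * Real.log (v t ω))) ∂P < ⊤ := by
    have := hu.log_lt_top
    simp_rw [hcongr fun t a => ENNReal.ofReal (Real.exp (-ρ * t) * Real.log a)] at this
    exact this
  have hae : ∀ᵐ ω ∂P, (∫⁻ t in Ici (0 : ℝ),
        ENNReal.ofReal (Real.exp (-ρ * t) * (Real.log (u t ω) - c * x t ω ^ 2))) +
        ENNReal.ofReal (-V) ≤
      (∫⁻ t in Ici (0 : ℝ),
        ENNReal.ofReal (-(Real.exp (-ρ * t) * (Real.log (u t ω) - c * x t ω ^ 2)))) +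
        ENNReal.ofReal V := by
    filter_upwards [hu.locallyIntegrable, ae_lt_top hlogm hlog.ne, hx.continuous, hx.nonneg,
      hx.equation] with ω h1 h2 h3 h4 h5
    rw [hcongr fun t a => ENNReal.ofReal (Real.exp (-ρ * t) * (Real.log a - c * x t ω ^ 2)),
      hcongr fun t a => ENNReal.ofReal (-(Real.exp (-ρ * t) * (Real.log a - c * x t ω ^ 2)))]
    refine lintegral_payoff_le hr hρ hc hx₀ (u := fun t => v t ω) (x := fun t => x t ω)
      (hvm.comp (measurable_const.prodMk measurable_id)) (fun t ht => ?_) (fun T hT => ?_) h2 h3 h4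
      fun t ht => ?_
    · rw [hvu t ht]; exact hu.pos t ht ω
    · refine (h1 T hT).congr fun t ht => ?_
      rw [uIoc_of_le hT] at ht
      rw [hvu t ht.1.le]
    · rw [h5 t ht]
      congr 1
      refine intervalIntegral.integral_congr fun s hs => ?_
      rw [hvu s (uIcc_zero_subset_Ici ht hs)]
  -- Only the added constants have to be measurable to split these integrals, so joint measurability
  -- of the state is not needed.
  have hint := lintegral_mono_ae hae
  rw [lintegral_add_right _ measurable_const, lintegral_add_right _ measurable_const,
    lintegral_const, lintegral_const, measure_univ, mul_one, mul_one] at hint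
  have hA : ∫⁻ ω, (∫⁻ t in Ici (0 : ℝ),
      ENNReal.ofReal (Real.exp (-ρ * t) * (Real.log (u t ω) - c * x t ω ^ 2))) ∂P ≠ ⊤ := by
    refine ne_top_of_le_ne_top hu.log_lt_top.ne (lintegral_mono fun ω => lintegral_mono fun t =>
      ENNReal.ofReal_le_ofReal (mul_le_mul_of_nonneg_left ?_ (Real.exp_pos _).le))
    have : 0 ≤ c * x t ω ^ 2 := by positivity
    linarith
  rw [benefit]
  set A := ∫⁻ ω, (∫⁻ t in Ici (0 : ℝ),
    ENNReal.ofReal (Real.exp (-ρ * t) * (Real.log (u t ω) - c * x t ω ^ 2))) ∂P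
  set B := ∫⁻ ω, (∫⁻ t in Ici (0 : ℝ),
    ENNReal.ofReal (-(Real.exp (-ρ * t) * (Real.log (u t ω) - c * x t ω ^ 2)))) ∂P
  rcases eq_or_ne B ⊤ with hB | hB
  · rw [hB]; simp
  · rw [← EReal.coe_ennreal_toReal hA, ← EReal.coe_ennreal_toReal hB, ← EReal.coe_sub,
      EReal.coe_le_coe_iff]
    have h1 := ENNReal.toReal_mono (ENNReal.add_ne_top.2 ⟨hB, ENNReal.ofReal_ne_top⟩) hint
    rw [ENNReal.toReal_add hA ENNReal.ofReal_ne_top, ENNReal.toReal_add hB ENNReal.ofReal_ne_top,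
      ENNReal.toReal_ofReal', ENNReal.toReal_ofReal'] at h1
    rcases le_total 0 V with h | h
    · rw [max_eq_left h, max_eq_right (neg_nonpos.2 h)] at h1; linarith
    · rw [max_eq_right h, max_eq_left (neg_nonneg.2 h)] at h1; linarith

theorem value_eq_pathValue [IsProbabilityMeasure P] (hr : IsTame K r) (hK : 0 < K) (hρ : 0 < ρ)
    (hb : 0 < b) (hc : 0 < c) (hx₀ : 0 ≤ x₀) :
    value P ℱ ρ b c r x₀ = (pathValue ρ b c r x₀ : EReal) := by
  refine le_antisymm (sSup_le ?_) (le_of_forall_lt fun a ha => ?_)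
  · rintro _ ⟨u, x, hu, hx, rfl⟩
    exact benefit_le_pathValue P ℱ hr hρ hc hx₀ hu hx
  · obtain ⟨z, hz1, hz2⟩ := EReal.lt_iff_exists_real_btwn.1 ha
    have hz2' := EReal.coe_lt_coe_iff.1 hz2
    obtain ⟨u, x, hp, hJ⟩ := exists_lt_payoff (c := c) hr hK hρ hb hc hx₀ (sub_pos.2 hz2')
    rw [sub_sub_cancel] at hJ
    refine (hz1.trans (EReal.coe_lt_coe_iff.2 hJ)).trans_le (le_sSup ?_)
    exact ⟨_, _, hp.isAdmissible P ℱ hr hb, hp.isSolution P ℱ, (hp.benefit_eq P).symm⟩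

end Lift

end ShallowLake

theorem mainTheorem4 {Ω : Type*} {mΩ : MeasurableSpace Ω} (P : Measure Ω) [IsProbabilityMeasure P]
    (ℱ : Filtration ℝ≥0 mΩ) (ρ b c : ℝ) (hρ : 0 < ρ) (hb : 0 < b) (hc : 0 < c)
    (r : ℝ → ℝ) (hr : ShallowLake.IsRecyclingRate b ρ r) :
    ∃ V : ℝ → ℝ,
      (∀ x ≥ 0, ShallowLake.value P ℱ ρ b c r x = (V x : EReal)) ∧
      ContinuousOn V (Ici 0) ∧
      ShallowLake.IsConstrainedViscositySolution (ShallowLake.hjb ρ b c r) V ∧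
      ∃ p < 0, HasDerivWithinAt V p (Ici 0) 0 ∧ Real.log (-p) + ρ * V 0 + 1 = 0 := by
  obtain ⟨K, hK, hK'⟩ := hr.exists_isTame
  refine ⟨ShallowLake.pathValue ρ b c r,
    fun x hx => ShallowLake.value_eq_pathValue P ℱ hK' hK hρ hb hc hx,
    ShallowLake.continuousOn_pathValue hK' hK hρ hb hc,
    ⟨ShallowLake.isViscositySubsolution_pathValue hK' hK hρ hb hc,
      ShallowLake.isViscositySupersolution_pathValue hK' hK hρ hb hc⟩,
    _, neg_lt_zero.2 (Real.exp_pos _),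
    ShallowLake.hasDerivWithinAt_pathValue_zero hK' hr.map_zero hK hρ hb hc, ?_⟩
  rw [neg_neg, Real.log_exp]
  ring
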